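/- Let $n\ge 2$, let $p>1$, with $p<\frac{n+2}{n-2}$ if $n>2$, and let $c\in\mathbb{R}^n$ with $|c|<1$. All functions are real-valued. Let $L_c$ and $L_c^{1/2}$ be the Fourier multiplier operators on $L^2(\mathbb{R}^n)$ with symbols $-\frac{(c\cdot\xi)^2}{|\xi|^2}$ and $\frac{i\,c\cdot\xi}{|\xi|}$ (that is, $L_c=(c\cdot\nabla)^2(-\Delta)^{-1}$). For $u\in H^1(\mathbb{R}^n)$ put $$J(u)=\tfrac12\int_{\mathbb{R}^n}\bigl(|\nabla u|^2+u^2-|L_c^{1/2}u|^2\bigr)\,dx,\qquad K(u)=\tfrac1{p+1}\int_{\mathbb{R}^n}|u|^{p+1}\,dx,$$ and for $\lambda>0$ put $m(c,\lambda)=\inf\{J(u): u\in H^1(\mathbb{R}^n),\ K(u)=\lambda\}$ and $m(c)=m(c,1)$. 1. Let $\lambda>0$ and let $(\varphi_k)\subset H^1(\mathbb{R}^n)$ satisfy $J(\varphi_k)\to m(c,\lambda)$ and $K(\varphi_k)\to\lambda$. Then there are a subsequence $(\varphi_{k_j})$, points $y_j\in\mathbb{R}^n$ and $\varphi\in H^1(\mathbb{R}^n)$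 such that $\varphi_{k_j}(\cdot+y_j)\to\varphi$ in $H^1(\mathbb{R}^n)$, and $\varphi$ minimizes $J$ over $H^1(\mathbb{R}^n)$ subject to $K=\lambda$. 2. For every $\lambda>0$ there is a minimizer of $J$ over $H^1(\mathbb{R}^n)$ subject to $K=\lambda$. 3. For every $\lambda>0$ and every such minimizer $\varphi$ there is $\ell>0$ such that $\varphi$ is a weak solution in $H^1(\mathbb{R}^n)$ of $(I+L_c)\varphi-\Delta\varphi=\ell\,|\varphi|^{p-1}\varphi$, and $\phi=\ell^{1/(p-1)}\varphi$ is a ground state of $$(I+L_c)\phi-\Delta\phi=|\phi|^{p-1}\phi,$$ i.e. $\phi\neq0$ is a weak solution in $H^1(\mathbb{R}^n)$ (tested against all $v\in H^1(\mathbb{R}^n)$) with $J(\phi)\,K(\phi)^{-2/(p+1)}=m(c)$ and $$(p+1)K(\phi)=2J(\phi)=2\Bigl(\frac{2}{p+1}\Bigr)^{\frac{2}{p-1}}m(c)^{\frac{p+1}{p-1}}.$$ -/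

import Mathlib

open MeasureTheory Filter Topology
open scoped ContDiff FourierTransform

noncomputable section

namespace BoussinesqWave

/-- The space `ℝⁿ` with its Euclidean norm. -/
abbrev E (n : ℕ) : Type := EuclideanSpace ℝ (Fin n)

/-- The space `L²(ℝⁿ; ℂ)`. -/
abbrev L2C (n : ℕ) : Type := Lp ℂ 2 (volume : Measure (E n))

/-! ### The Sobolev space `H¹(ℝⁿ)` of real-valued functions -/

/-- `g` is the weak (distributional) gradient of `u` : for every test function `η` and every
direction `w`, `∫ u ∂_w η = - ∫ (g · w) η`. It is used only for `u` and `g` in `L²`. -/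
def HasWeakGrad {n : ℕ} (u : E n → ℝ) (g : E n → E n) : Prop :=
  ∀ η : E n → ℝ, ContDiff ℝ ∞ η → HasCompactSupport η → ∀ w : E n,
    ∫ x, u x * fderiv ℝ η x w = - ∫ x, inner ℝ (g x) w * η x

/-- `u ∈ H¹(ℝⁿ)` : `u` is in `L²` and has a weak gradient in `L²`. -/
def MemH1 {n : ℕ} (u : E n → ℝ) : Prop :=
  MemLp u 2 volume ∧ ∃ g : E n → E n, MemLp g 2 volume ∧ HasWeakGrad u g

open Classical in
/-- The weak gradient of `u`, determined up to a null set when `u ∈ H¹(ℝⁿ)`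
(and set to `0` when `u` has no weak gradient in `L²`). -/
def weakGrad {n : ℕ} (u : E n → ℝ) : E n → E n :=
  if h : ∃ g : E n → E n, MemLp g 2 volume ∧ HasWeakGrad u g then h.choose else 0

/-- The norm of `H¹(ℝⁿ)`. -/
def h1Norm {n : ℕ} (u : E n → ℝ) : ℝ :=
  Real.sqrt (∫ x, (‖weakGrad u x‖ ^ 2 + u x ^ 2))

/-! ### The operators `L_c` and `L_c^{1/2}` as Fourier multipliers on `L²` -/

open Classical in
/-- The class in `L²(ℝⁿ; ℂ)` of a real-valued square integrable function
(and `0` when `u` is not square integrable). -/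
def toL2 {n : ℕ} (u : E n → ℝ) : L2C n :=
  if h : MemLp u 2 volume then
    MemLp.toLp (fun x => (u x : ℂ)) (MemLp.ofReal (K := ℂ) h) else 0

/-- The Fourier multiplier operator `f ↦ 𝓕⁻¹(m · 𝓕 f)` on `L²(ℝⁿ; ℂ)` with symbol `m ∈ L^∞`. -/
def fourierMul {n : ℕ} (m : E n → ℂ) (hm : MemLp m ⊤ volume) (f : L2C n) : L2C n :=
  𝓕⁻ (MemLp.toLp (fun ξ => m ξ * (𝓕 f : L2C n) ξ)
    (MemLp.mul (r := 2) (Lp.memLp (𝓕 f : L2C n)) hm) : L2C n)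

/-- The symbol `i (c·ξ) / |ξ|` of `L_c^{1/2} = (c·∇) (-Δ)^{-1/2}`. Being homogeneous of degree
zero, it does not depend on the normalization of the frequency variable. -/
def symbolHalf {n : ℕ} (c ξ : E n) : ℂ :=
  Complex.I * ((inner ℝ c ξ / ‖ξ‖ : ℝ) : ℂ)

/-- The symbol `-(c·ξ)² / |ξ|²` of `L_c = (c·∇)² (-Δ)⁻¹`. -/
def symbol {n : ℕ} (c ξ : E n) : ℂ :=
  ((-(inner ℝ c ξ ^ 2 / ‖ξ‖ ^ 2) : ℝ) : ℂ)

theorem abs_inner_div_norm_le {n : ℕ} (c ξ : E n) : |inner ℝ c ξ / ‖ξ‖| ≤ ‖c‖ := by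
  rw [abs_div, abs_norm]
  exact div_le_of_le_mul₀ (norm_nonneg _) (norm_nonneg _) (abs_real_inner_le_norm c ξ)

theorem memLp_symbolHalf {n : ℕ} (c : E n) : MemLp (symbolHalf c) ⊤ volume := by
  refine memLp_top_of_bound (C := ‖c‖) ?_ (ae_of_all _ fun ξ => ?_)
  · unfold symbolHalf
    have h : Measurable fun ξ : E n => inner ℝ c ξ / ‖ξ‖ :=
      (by fun_prop : Continuous fun ξ : E n => inner ℝ c ξ).measurable.div measurable_norm
    exact ((Complex.measurable_ofReal.comp h).const_mul _).aestronglyMeasurable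
  · rw [symbolHalf, norm_mul, Complex.norm_I, one_mul, Complex.norm_real, Real.norm_eq_abs]
    exact abs_inner_div_norm_le c ξ

theorem memLp_symbol {n : ℕ} (c : E n) : MemLp (symbol c) ⊤ volume := by
  refine memLp_top_of_bound (C := ‖c‖ ^ 2) ?_ (ae_of_all _ fun ξ => ?_)
  · unfold symbol
    have h : Measurable fun ξ : E n => -(inner ℝ c ξ ^ 2 / ‖ξ‖ ^ 2) :=
      (((by fun_prop : Continuous fun ξ : E n => inner ℝ c ξ).measurable.pow_const 2).div
        (measurable_norm.pow_const 2)).neg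
    exact (Complex.measurable_ofReal.comp h).aestronglyMeasurable
  · have h := pow_le_pow_left₀ (abs_nonneg _) (abs_inner_div_norm_le c ξ) 2
    rw [symbol, Complex.norm_real, Real.norm_eq_abs, abs_neg, ← div_pow, abs_pow]
    exact h

/-- `L_c^{1/2} u` for `u ∈ L²(ℝⁿ)`. -/
def LcHalf {n : ℕ} (c : E n) (u : E n → ℝ) : L2C n :=
  fourierMul (symbolHalf c) (memLp_symbolHalf c) (toL2 u)

/-- `L_c u` for `u ∈ L²(ℝⁿ)`. The symbol of `L_c` is real and even, so `L_c u` is real-valued for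
real-valued `u`; the real part only turns complex values with zero imaginary part into reals. -/
def Lc {n : ℕ} (c : E n) (u : E n → ℝ) (x : E n) : ℝ :=
  (fourierMul (symbol c) (memLp_symbol c) (toL2 u) x).re

/-! ### The variational problem -/

/-- `J(u) = ½ ∫ (|∇u|² + |u|² - |L_c^{1/2} u|²)`. -/
def J {n : ℕ} (c : E n) (u : E n → ℝ) : ℝ :=
  (1 / 2) * ∫ x, (‖weakGrad u x‖ ^ 2 + u x ^ 2 - ‖LcHalf c u x‖ ^ 2)

/-- `K(u) = (1 / (p + 1)) ∫ |u|^(p + 1)`. -/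
def K {n : ℕ} (p : ℝ) (u : E n → ℝ) : ℝ :=
  (1 / (p + 1)) * ∫ x, |u x| ^ (p + 1)

/-- `m(c, lam) = inf {J(u) : u ∈ H¹(ℝⁿ), K(u) = lam}`. -/
def mInf {n : ℕ} (c : E n) (p lam : ℝ) : ℝ :=
  sInf {r : ℝ | ∃ u : E n → ℝ, MemH1 u ∧ K p u = lam ∧ J c u = r}

/-- A minimizing sequence: `J(u_k) → m(c, lam)` and `K(u_k) → lam`. -/
def IsMinimizingSeq {n : ℕ} (c : E n) (p lam : ℝ) (u : ℕ → E n → ℝ) : Prop :=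
  (∀ k, MemH1 (u k)) ∧ Tendsto (fun k => J c (u k)) atTop (𝓝 (mInf c p lam)) ∧
    Tendsto (fun k => K p (u k)) atTop (𝓝 lam)

/-- `φ` minimizes `J` over `H¹(ℝⁿ)` subject to the constraint `K = lam`. -/
def IsConstrainedMinimizer {n : ℕ} (c : E n) (p lam : ℝ) (φ : E n → ℝ) : Prop :=
  MemH1 φ ∧ K p φ = lam ∧ ∀ v : E n → ℝ, MemH1 v → K p v = lam → J c φ ≤ J c v

/-- `φ ∈ H¹(ℝⁿ)` is a weak solution of `(I + L_c) φ - Δφ = ℓ |φ|^(p-1) φ`, that is,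
`J'(φ) = ℓ K'(φ)` tested against all `v ∈ H¹(ℝⁿ)`. -/
def IsWeakSolution {n : ℕ} (c : E n) (p ℓ : ℝ) (φ : E n → ℝ) : Prop :=
  MemH1 φ ∧ ∀ v : E n → ℝ, MemH1 v →
    ∫ x, ((φ x + Lc c φ x) * v x + inner ℝ (weakGrad φ x) (weakGrad v x)) =
      ℓ * ∫ x, |φ x| ^ (p - 1) * φ x * v x

/-- A ground state of `(I + L_c) φ - Δφ = |φ|^(p-1) φ` : a nonzero weak solution in `H¹(ℝⁿ)` that
achieves `m(c) = m(c, 1)`, i.e. `J(φ) / K(φ)^(2/(p+1)) = m(c)`, and lies at the level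
`(p+1) K(φ) = 2 J(φ) = 2 (2/(p+1))^(2/(p-1)) m(c)^((p+1)/(p-1))`. -/
def IsGroundState {n : ℕ} (c : E n) (p : ℝ) (φ : E n → ℝ) : Prop :=
  IsWeakSolution c p 1 φ ∧ ¬ (φ =ᵐ[volume] 0) ∧
    J c φ / K p φ ^ (2 / (p + 1)) = mInf c p 1 ∧
    (p + 1) * K p φ = 2 * J c φ ∧
    2 * J c φ = 2 * (2 / (p + 1)) ^ (2 / (p - 1)) * mInf c p 1 ^ ((p + 1) / (p - 1))

end BoussinesqWave

end

open MeasureTheory Filter Topology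
open scoped ContDiff FourierTransform

noncomputable section

namespace BoussinesqWave

/-! ### The Fourier transform on L² and weak gradients -/

variable {n : ℕ}

/-! The functional `J` is half of a quadratic form on H¹. Since the symbol of `L_c^{1/2}` is bounded
by |c| < 1, this form is coercive. By homogeneity (degree 2 for `J`, degree p + 1 for `K`) every u
in H¹ satisfies J(u) ≥ m(c) K(u)^a with a = 2/(p+1), and m(c, λ) = m(c) λ^a. The subcritical Sobolev
embedding gives m(c) > 0. As a < 1, λ ↦ λ^a is strictly subadditive, so splitting the mass of a
minimizing sequence into two pieces costs energy.

Compactness rests on frequency truncation. The part of u with frequencies below A is a continuous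
function whose value at a point is a bounded linear functional of u, while the dyadic parts above A
are summably small in L^(p+1) by Bernstein's inequality and subcriticality
(`exists_eLpNorm_sub_low_le`). If the low frequency parts of a bounded sequence tend to zero
uniformly in space, the sequence tends to zero in L^(p+1), which K → λ > 0 forbids. Otherwise one
translates points where a low frequency part stays large to the origin; the evaluation there
survives weak limits, so a weak limit φ of the translates is nonzero
(`exists_translates_weakTendsto`). The same evaluations give convergence almost everywhere along a
subsequence (`exists_subseq_tendsto_ae`).

Now `J` splits along weak convergence by expanding the square (`tendsto_Q_sub`) and `K` splits by
the Brezis–Lieb lemma (`tendsto_K_sub`). The remainders have mass tending to λ − K(φ) and energy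
tending to m(c, λ) − J(φ). Strict subadditivity forces K(φ) = λ, hence J(φ) = m(c, λ); the
remainders then lose all energy, and coercivity turns this into convergence in H¹.

For the equation, a minimizer φ makes t ↦ J(φ + tv) − m(c) K(φ + tv)^a minimal at t = 0. The
derivative there vanishes, which gives the weak equation with an explicit multiplier; rescaling φ
removes the multiplier and puts it at the ground state level. -/

theorem fourier_pairing (f : L2C n) (ψ : SchwartzMap (E n) ℂ) :
    ∫ ξ, ψ ξ * (𝓕 f : L2C n) ξ = ∫ x, (𝓕 ψ : SchwartzMap (E n) ℂ) x * f x := by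
  have h := congrArg (fun T => T ψ) (Lp.fourier_toTemperedDistribution_eq f)
  simpa using h.symm

theorem fourierInv_pairing (f : L2C n) (ψ : SchwartzMap (E n) ℂ) :
    ∫ ξ, ψ ξ * (𝓕⁻ f : L2C n) ξ = ∫ x, (𝓕⁻ ψ : SchwartzMap (E n) ℂ) x * f x := by
  have h := congrArg (fun T => T ψ) (Lp.fourierInv_toTemperedDistribution_eq f)
  simpa using h.symm

theorem MemLp.locallyIntegrable_two {F : Type*} [NormedAddCommGroup F] {f : E n → F}
    (hf : MemLp f 2 volume) : LocallyIntegrable f volume :=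
  hf.locallyIntegrable (by norm_num)

/-- Two locally integrable functions with the same integrals against compactly supported smooth
complex functions agree almost everywhere. -/
theorem ae_eq_of_forall_test {f g : E n → ℂ} (hf : LocallyIntegrable f volume)
    (hg : LocallyIntegrable g volume)
    (h : ∀ ψ : E n → ℂ, ContDiff ℝ ∞ ψ → HasCompactSupport ψ →
      ∫ x, ψ x * f x = ∫ x, ψ x * g x) : f =ᵐ[volume] g := by
  refine ae_eq_of_integral_contDiff_smul_eq hf hg fun η h1 h2 => ?_
  have := h (fun x => (η x : ℂ)) (Complex.ofRealCLM.contDiff.comp h1)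
    (h2.comp_left (g := fun t : ℝ => (t : ℂ)) rfl)
  simpa using this

/-- The inverse Fourier transform in `L²` of a function in `L¹ ∩ L²` is given by the integral. -/
theorem fourierInv_toLp_ae_eq {g : E n → ℂ} (h1 : Integrable g volume) (h2 : MemLp g 2 volume) :
    ((𝓕⁻ (h2.toLp g : L2C n) : L2C n) : E n → ℂ) =ᵐ[volume] (𝓕⁻ g : E n → ℂ) := by
  have hcont : Continuous (𝓕⁻ g : E n → ℂ) := by
    rw [Real.fourierInv_eq_fourier_comp_neg]
    exact VectorFourier.fourierIntegral_continuous Real.continuous_fourierChar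
      (continuous_inner : Continuous fun p : E n × E n => innerₗ (E n) p.1 p.2) h1.comp_neg
  refine ae_eq_of_forall_test (MemLp.locallyIntegrable_two (Lp.memLp _))
    hcont.locallyIntegrable fun ψ hψ hc => ?_
  have e1 := fourierInv_pairing (h2.toLp g) (hc.toSchwartzMap hψ)
  have e2 : ∫ x, (𝓕⁻ (hc.toSchwartzMap hψ) : SchwartzMap (E n) ℂ) x * (h2.toLp g) x =
      ∫ x, (𝓕⁻ ψ : E n → ℂ) x * g x := by
    refine integral_congr_ae ?_
    filter_upwards [h2.coeFn_toLp] with x hx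
    rw [hx, SchwartzMap.fourierInv_coe]
    rfl
  have e3 : ∫ x, (𝓕⁻ ψ : E n → ℂ) x * g x = ∫ x, ψ x * (𝓕⁻ g : E n → ℂ) x := by
    have hψi : Integrable ψ volume := hψ.continuous.integrable_of_hasCompactSupport hc
    -- The multiplication formula is applied to the forward transform and to the reflected function
    -- g(−x), because 𝓕⁻ g is the forward transform of that reflection; a change of sign in the
    -- remaining integral finishes.
    have := VectorFourier.integral_fourierIntegral_smul_eq_flip (μ := volume) (ν := volume)
      (L := innerₗ (E n)) (e := Real.fourierChar) (f := fun x => ψ x) (g := fun x => g (-x))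
      Real.continuous_fourierChar
      continuous_inner hψi h1.comp_neg
    rw [Real.fourierInv_eq_fourier_comp_neg g]
    have h3 : (innerₗ (E n)).flip = innerₗ (E n) := by
      ext x y; simp
    rw [h3] at this
    rw [← integral_neg_eq_self]
    simp only [Real.fourierInv_eq_fourier_neg, neg_neg]
    simpa using! this
  simpa [e2, e3] using e1



/-- Translation becomes multiplication by a character under the Fourier transform in `L²`. -/
theorem fourier_translate_ae_eq {f g : L2C n} {y : E n}
    (hfg : (g : E n → ℂ) =ᵐ[volume] fun x => f (x + y)) :
    ((𝓕 g : L2C n) : E n → ℂ) =ᵐ[volume]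
      fun ξ => (Real.fourierChar (inner ℝ ξ y) : ℂ) * (𝓕 f : L2C n) ξ := by
  have hch : ContDiff ℝ ∞ fun ξ : E n => (Real.fourierChar (inner ℝ ξ y) : ℂ) := by
    simp only [Real.fourierChar_apply]
    have : ContDiff ℝ ∞ fun ξ : E n => ((inner ℝ ξ y : ℝ) : ℂ) :=
      Complex.ofRealCLM.contDiff.comp (contDiff_id.inner ℝ contDiff_const)
    push_cast
    exact ((contDiff_const.mul this).mul contDiff_const).cexp
  have hli : LocallyIntegrable
      (fun ξ => (Real.fourierChar (inner ℝ ξ y) : ℂ) * (𝓕 f : L2C n) ξ) volume := by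
    refine MemLp.locallyIntegrable_two ?_
    refine (Lp.memLp (𝓕 f : L2C n)).of_le
      (hch.continuous.aestronglyMeasurable.mul (Lp.aestronglyMeasurable _)) (ae_of_all _ fun ξ => ?_)
    rw [norm_mul, Circle.norm_coe, one_mul]
  refine ae_eq_of_forall_test (MemLp.locallyIntegrable_two (Lp.memLp _)) hli fun ψ hψ hc => ?_
  have hψ' : ContDiff ℝ ∞ fun ξ => ψ ξ * (Real.fourierChar (inner ℝ ξ y) : ℂ) := hψ.mul hch
  have hc' : HasCompactSupport fun ξ => ψ ξ * (Real.fourierChar (inner ℝ ξ y) : ℂ) :=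
    hc.mul_right
  have e1 := fourier_pairing g (hc.toSchwartzMap hψ)
  have e2 := fourier_pairing f (hc'.toSchwartzMap hψ')
  have e3 : ∫ x, (𝓕 (hc.toSchwartzMap hψ) : SchwartzMap (E n) ℂ) x * g x =
      ∫ x, (𝓕 (hc'.toSchwartzMap hψ') : SchwartzMap (E n) ℂ) x * f x := by
    rw [← integral_add_right_eq_self
      (fun x => (𝓕 (hc'.toSchwartzMap hψ') : SchwartzMap (E n) ℂ) x * f x) y]
    refine integral_congr_ae ?_
    filter_upwards [hfg] with x hx
    rw [hx, SchwartzMap.fourier_coe, SchwartzMap.fourier_coe]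
    congr 1
    change 𝓕 ψ x = 𝓕 (fun ξ => ψ ξ * (Real.fourierChar (inner ℝ ξ y) : ℂ)) (x + y)
    rw [Real.fourier_eq, Real.fourier_eq]
    refine integral_congr_ae (ae_of_all _ fun v => ?_)
    simp only [Circle.smul_def, smul_eq_mul, inner_add_right, neg_add]
    rw [AddChar.map_add_eq_mul, AddChar.map_neg_eq_inv _ (inner ℝ v y)]
    push_cast
    field_simp
  calc _ = _ := e1
    _ = _ := e3
    _ = ∫ ξ, ψ ξ * (Real.fourierChar (inner ℝ ξ y) : ℂ) * (𝓕 f : L2C n) ξ := e2.symm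
    _ = _ := by simp only [mul_assoc]

theorem ae_eq_toL2 {u : E n → ℝ} (hu : MemLp u 2 volume) :
    (toL2 u : E n → ℂ) =ᵐ[volume] fun x => (u x : ℂ) := by
  rw [toL2, dif_pos hu]
  exact MemLp.coeFn_toLp _

/-- Complex-valued compactly supported test functions are admissible for the weak gradient. -/
theorem HasWeakGrad.complex {u : E n → ℝ} {g : E n → E n} (hu : MemLp u 2 volume)
    (hg : MemLp g 2 volume) (h : HasWeakGrad u g) {η : E n → ℂ} (hη : ContDiff ℝ ∞ η)
    (hc : HasCompactSupport η) (w : E n) :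
    ∫ x, (u x : ℂ) * fderiv ℝ η x w = - ∫ x, ((inner ℝ (g x) w : ℝ) : ℂ) * η x := by
  have hre : ContDiff ℝ ∞ fun x => (η x).re := Complex.reCLM.contDiff.comp hη
  have him : ContDiff ℝ ∞ fun x => (η x).im := Complex.imCLM.contDiff.comp hη
  have cre : HasCompactSupport fun x => (η x).re := hc.comp_left (g := Complex.re) rfl
  have cim : HasCompactSupport fun x => (η x).im := hc.comp_left (g := Complex.im) rfl
  have hd : ∀ x, DifferentiableAt ℝ η x := fun x => hη.differentiable (by simp) x
  have dre : ∀ x, fderiv ℝ (fun x => (η x).re) x w = (fderiv ℝ η x w).re := fun x => by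
    have := (Complex.reCLM.hasFDerivAt (x := η x)).comp x (hd x).hasFDerivAt
    rw [show (fun x => (η x).re) = Complex.reCLM ∘ η from rfl, this.fderiv]; rfl
  have dim : ∀ x, fderiv ℝ (fun x => (η x).im) x w = (fderiv ℝ η x w).im := fun x => by
    have := (Complex.imCLM.hasFDerivAt (x := η x)).comp x (hd x).hasFDerivAt
    rw [show (fun x => (η x).im) = Complex.imCLM ∘ η from rfl, this.fderiv]; rfl
  have i1 : Integrable (fun x => (u x : ℂ) * fderiv ℝ η x w) volume := by
    have h1 : MemLp (fun x => fderiv ℝ η x w) 2 volume := by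
      refine Continuous.memLp_of_hasCompactSupport ?_ ?_
      · exact (hη.continuous_fderiv (by simp)).clm_apply continuous_const
      · exact (hc.fderiv ℝ).comp_left (g := fun L : E n →L[ℝ] ℂ => L w) rfl
    exact MemLp.integrable_mul (p := 2) (q := 2) (hu.ofReal (K := ℂ)) h1
  have hgw : MemLp (fun x => inner ℝ (g x) w) 2 volume := hg.inner_const w
  have i2 : Integrable (fun x => ((inner ℝ (g x) w : ℝ) : ℂ) * η x) volume :=
    MemLp.integrable_mul (p := 2) (q := 2) (hgw.ofReal (K := ℂ))
      (hη.continuous.memLp_of_hasCompactSupport hc)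
  have r1 := h _ hre cre w
  have r2 := h _ him cim w
  simp only [dre] at r1
  simp only [dim] at r2
  apply Complex.ext
  · rw [Complex.neg_re]
    have a := integral_re i1
    have b := integral_re i2
    simp only [RCLike.re_eq_complex_re, Complex.re_ofReal_mul] at a b
    rw [← a, ← b, r1]
  · rw [Complex.neg_im]
    have a := integral_im i1
    have b := integral_im i2
    simp only [RCLike.im_eq_complex_im, Complex.im_ofReal_mul] at a b
    rw [← a, ← b, r2]

/-- The defining identity of the weak gradient of `u ∈ H¹` extends to smooth `η ∈ H¹`. -/
theorem HasWeakGrad.of_memLp {u : E n → ℝ} {g : E n → E n} (hu : MemLp u 2 volume)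
    (hg : MemLp g 2 volume) (h : HasWeakGrad u g) {η : E n → ℂ} (hη : ContDiff ℝ ∞ η)
    (hη2 : MemLp η 2 volume) (w : E n) (hdη : MemLp (fun x => fderiv ℝ η x w) 2 volume) :
    ∫ x, (u x : ℂ) * fderiv ℝ η x w = - ∫ x, ((inner ℝ (g x) w : ℝ) : ℂ) * η x := by
  -- The test function η is cut off by χ(t_k x) with t_k → 0. The extra term in the derivative of
  -- the product carries a factor t_k, so it disappears in the limit by dominated convergence.
  let χ : ContDiffBump (0 : E n) := ⟨1, 2, one_pos, one_lt_two⟩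
  have hχ : ContDiff ℝ ∞ (χ : E n → ℝ) := χ.contDiff
  obtain ⟨C, hC⟩ : ∃ C, ∀ x, ‖fderiv ℝ (χ : E n → ℝ) x w‖ ≤ C := by
    have h1 : Continuous fun x => fderiv ℝ (χ : E n → ℝ) x w :=
      (hχ.continuous_fderiv (by simp)).clm_apply continuous_const
    exact h1.bounded_above_of_compact_support
      ((χ.hasCompactSupport.fderiv ℝ).comp_left (g := fun L : E n →L[ℝ] ℝ => L w) rfl)
  let t : ℕ → ℝ := fun k => 1 / ((k : ℝ) + 1)
  have ht : Tendsto t atTop (𝓝 0) := tendsto_one_div_add_atTop_nhds_zero_nat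
  have htpos : ∀ k, 0 < t k := fun k => by positivity
  have htle : ∀ k, t k ≤ 1 := fun k => by
    simp only [t]; rw [div_le_one (by positivity)]; linarith [(Nat.cast_nonneg k : (0:ℝ) ≤ k)]
  have hχt : ∀ k, ContDiff ℝ ∞ fun x => ((χ (t k • x) : ℝ) : ℂ) := fun k =>
    Complex.ofRealCLM.contDiff.comp (hχ.comp (contDiff_const_smul _))
  have hχc : ∀ k, HasCompactSupport fun x => ((χ (t k • x) : ℝ) : ℂ) := fun k =>
    (χ.hasCompactSupport.comp_smul (htpos k).ne').comp_left (g := fun s : ℝ => (s : ℂ)) rfl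
  have hχ1 : ∀ x, Tendsto (fun k => ((χ (t k • x) : ℝ) : ℂ)) atTop (𝓝 1) := fun x => by
    have : Tendsto (fun k => t k • x) atTop (𝓝 ((0 : ℝ) • x)) := ht.smul_const x
    have h2 := (χ.continuous.tendsto ((0 : ℝ) • x)).comp this
    rw [zero_smul, χ.one_of_mem_closedBall (by simp [χ])] at h2
    exact_mod_cast (Complex.continuous_ofReal.tendsto _).comp h2
  have dχ : ∀ k x, fderiv ℝ (fun x => ((χ (t k • x) : ℝ) : ℂ)) x w =
      ((t k * fderiv ℝ (χ : E n → ℝ) (t k • x) w : ℝ) : ℂ) := fun k x => by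
    have h1 : HasFDerivAt (fun x : E n => t k • x) (t k • ContinuousLinearMap.id ℝ (E n)) x :=
      (hasFDerivAt_id x).const_smul (t k)
    have h2 := ((hχ.differentiable (by simp)) (t k • x)).hasFDerivAt.comp x h1
    have h3 := (Complex.ofRealCLM.hasFDerivAt (x := χ (t k • x))).comp x h2
    rw [show (fun x => ((χ (t k • x) : ℝ) : ℂ)) =
      (Complex.ofRealCLM ∘ (χ : E n → ℝ) ∘ fun x => t k • x) from rfl, h3.fderiv]
    simp
  have key : ∀ k, ∫ x, (u x : ℂ) * (((χ (t k • x) : ℝ) : ℂ) * fderiv ℝ η x w +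
      ((t k * fderiv ℝ (χ : E n → ℝ) (t k • x) w : ℝ) : ℂ) * η x) =
      - ∫ x, ((inner ℝ (g x) w : ℝ) : ℂ) * (((χ (t k • x) : ℝ) : ℂ) * η x) := fun k => by
    have h1 := h.complex hu hg ((hχt k).mul hη) (hc := (hχc k).mul_right) w
    rw [← h1]
    refine integral_congr_ae (ae_of_all _ fun x => ?_)
    dsimp only
    congr 1
    rw [← dχ k x]
    have := ((((hχt k).differentiable (by simp)) x).hasFDerivAt.mul
      ((hη.differentiable (by simp)) x).hasFDerivAt).fderiv
    rw [show (fun x => ((χ (t k • x) : ℝ) : ℂ) * η x) =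
      ((fun x => ((χ (t k • x) : ℝ) : ℂ)) * η) from rfl, this]
    simp [mul_comm]
  have huc := hu.ofReal (K := ℂ)
  have hgw : MemLp (fun x => ((inner ℝ (g x) w : ℝ) : ℂ)) 2 volume :=
    (hg.inner_const w).ofReal (K := ℂ)
  have hχle : ∀ x, ‖((χ x : ℝ) : ℂ)‖ ≤ 1 := fun x => by
    rw [Complex.norm_real, Real.norm_eq_abs, abs_of_nonneg χ.nonneg]; exact χ.le_one
  have lim1 : Tendsto (fun k => ∫ x, (u x : ℂ) * (((χ (t k • x) : ℝ) : ℂ) * fderiv ℝ η x w +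
      ((t k * fderiv ℝ (χ : E n → ℝ) (t k • x) w : ℝ) : ℂ) * η x)) atTop
      (𝓝 (∫ x, (u x : ℂ) * fderiv ℝ η x w)) := by
    refine tendsto_integral_of_dominated_convergence
      (fun x => ‖(u x : ℂ) * fderiv ℝ η x w‖ + C * ‖(u x : ℂ) * η x‖) (fun k => ?_)
      (((huc.integrable_mul hdη).norm).add ((huc.integrable_mul hη2).norm.const_mul C))
      (fun k => ae_of_all _ fun x => ?_) (ae_of_all _ fun x => ?_)
    · refine huc.1.mul (((hχt k).continuous.aestronglyMeasurable.mul hdη.1).add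
        (Continuous.aestronglyMeasurable ?_ |>.mul hη2.1))
      refine Complex.continuous_ofReal.comp (continuous_const.mul ?_)
      exact ((hχ.continuous_fderiv (by simp)).comp (continuous_const_smul _)).clm_apply
        continuous_const
    · have a1 := hχle (t k • x)
      have a2 : ‖((t k * fderiv ℝ (χ : E n → ℝ) (t k • x) w : ℝ) : ℂ)‖ ≤ C := by
        rw [Complex.norm_real, norm_mul, Real.norm_eq_abs, abs_of_pos (htpos k)]
        have := hC (t k • x)
        nlinarith [htle k, htpos k, norm_nonneg (fderiv ℝ (χ : E n → ℝ) (t k • x) w)]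
      rw [mul_add]
      refine (norm_add_le _ _).trans (add_le_add ?_ ?_)
      · rw [norm_mul, norm_mul, norm_mul]
        gcongr
        exact mul_le_of_le_one_left (norm_nonneg _) a1
      · rw [norm_mul, norm_mul, norm_mul, mul_left_comm]
        gcongr
    · have a2 : Tendsto (fun k => ((t k * fderiv ℝ (χ : E n → ℝ) (t k • x) w : ℝ) : ℂ))
          atTop (𝓝 0) := by
        rw [tendsto_zero_iff_norm_tendsto_zero]
        refine squeeze_zero (fun _ => norm_nonneg _) (fun k => ?_) (by simpa using ht.mul_const C)
        rw [Complex.norm_real, norm_mul, Real.norm_eq_abs, abs_of_pos (htpos k)]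
        exact mul_le_mul_of_nonneg_left (hC _) (htpos k).le
      simpa using (((hχ1 x).mul_const (fderiv ℝ η x w)).add (a2.mul_const (η x))).const_mul
        (u x : ℂ)
  have lim2 : Tendsto (fun k => - ∫ x, ((inner ℝ (g x) w : ℝ) : ℂ) *
      (((χ (t k • x) : ℝ) : ℂ) * η x)) atTop
      (𝓝 (- ∫ x, ((inner ℝ (g x) w : ℝ) : ℂ) * η x)) := by
    refine (tendsto_integral_of_dominated_convergence
      (fun x => ‖((inner ℝ (g x) w : ℝ) : ℂ) * η x‖) (fun k => ?_)
      (hgw.integrable_mul hη2).norm (fun k => ae_of_all _ fun x => ?_)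
      (ae_of_all _ fun x => ?_)).neg
    · exact hgw.1.mul ((hχt k).continuous.aestronglyMeasurable.mul hη2.1)
    · rw [norm_mul, norm_mul, norm_mul]
      gcongr
      exact mul_le_of_le_one_left (norm_nonneg _) (hχle _)
    · simpa using ((hχ1 x).mul_const (η x)).const_mul ((inner ℝ (g x) w : ℝ) : ℂ)
  simp only [key] at lim1
  exact tendsto_nhds_unique lim1 lim2

/-- The Fourier transform of the weak gradient. -/
theorem HasWeakGrad.fourier_ae_eq {u : E n → ℝ} {g : E n → E n} (hu : MemLp u 2 volume)
    (hg : MemLp g 2 volume) (h : HasWeakGrad u g) (w : E n) :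
    ((𝓕 (toL2 fun x => inner ℝ (g x) w) : L2C n) : E n → ℂ) =ᵐ[volume]
      fun ξ => 2 * Real.pi * Complex.I * ((inner ℝ ξ w : ℝ) : ℂ) * (𝓕 (toL2 u) : L2C n) ξ := by
  have hgw : MemLp (fun x => inner ℝ (g x) w) 2 volume := hg.inner_const w
  have hch : ContDiff ℝ ∞ fun ξ : E n => 2 * Real.pi * Complex.I * ((inner ℝ ξ w : ℝ) : ℂ) :=
    contDiff_const.mul (Complex.ofRealCLM.contDiff.comp (contDiff_id.inner ℝ contDiff_const))
  have hli : LocallyIntegrable (fun ξ => 2 * Real.pi * Complex.I * ((inner ℝ ξ w : ℝ) : ℂ) *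
      (𝓕 (toL2 u) : L2C n) ξ) volume := by
    have := (MemLp.locallyIntegrable_two (Lp.memLp (𝓕 (toL2 u) : L2C n))).continuous_smul
      (g := fun ξ : E n => 2 * Real.pi * Complex.I * ((inner ℝ ξ w : ℝ) : ℂ)) hch.continuous
    simpa using! this
  refine ae_eq_of_forall_test (MemLp.locallyIntegrable_two (Lp.memLp _)) hli fun ψ hψ hc => ?_
  have hψ' : ContDiff ℝ ∞ fun ξ => ψ ξ * (2 * Real.pi * Complex.I * ((inner ℝ ξ w : ℝ) : ℂ)) :=
    hψ.mul hch
  have hc' : HasCompactSupport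
      fun ξ => ψ ξ * (2 * Real.pi * Complex.I * ((inner ℝ ξ w : ℝ) : ℂ)) := hc.mul_right
  set Ψ := hc.toSchwartzMap hψ
  set Ψ' := hc'.toSchwartzMap hψ'
  have e1 := fourier_pairing (toL2 fun x => inner ℝ (g x) w) Ψ
  have e2 := fourier_pairing (toL2 u) Ψ'
  have hd : ∀ x, fderiv ℝ (𝓕 Ψ : SchwartzMap (E n) ℂ) x w =
      - (𝓕 Ψ' : SchwartzMap (E n) ℂ) x := fun x => by
    have h1 := congrArg (fun T : SchwartzMap (E n) ℂ => T x)
      (SchwartzMap.lineDerivOp_fourier_eq Ψ w)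
    -- Differentiating 𝓕 Ψ multiplies Ψ by −2πi(ξ·w), so the derivative is −𝓕 Ψ'.
    have h2 : -(2 * Real.pi * Complex.I) • SchwartzMap.smulLeftCLM ℂ (inner ℝ · w) Ψ = -Ψ' := by
      ext ξ
      have ht : (fun ξ : E n => inner ℝ ξ w).HasTemperateGrowth :=
        ((innerSL ℝ).flip w).hasTemperateGrowth
      simp only [smul_apply, neg_apply,
        SchwartzMap.smulLeftCLM_apply_apply ht]
      change _ = -(ψ ξ * (2 * Real.pi * Complex.I * ((inner ℝ ξ w : ℝ) : ℂ)))
      change -(2 * Real.pi * Complex.I) * ((inner ℝ ξ w : ℝ) • ψ ξ) = _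
      rw [Complex.real_smul]; ring
    rw [h2, FourierTransform.fourier_neg] at h1
    exact h1
  -- 𝓕 Ψ is Schwartz but not compactly supported in general, hence the extended form of the weak
  -- gradient identity.
  have e3 := h.of_memLp hu hg (η := (𝓕 Ψ : SchwartzMap (E n) ℂ)) (SchwartzMap.smooth _ _)
    (SchwartzMap.memLp _ 2 volume) w (by
      simp only [hd]
      exact (SchwartzMap.memLp _ 2 volume).neg)
  have e4 : ∫ x, (𝓕 Ψ : SchwartzMap (E n) ℂ) x * (toL2 fun x => inner ℝ (g x) w) x =
      ∫ x, ((inner ℝ (g x) w : ℝ) : ℂ) * (𝓕 Ψ : SchwartzMap (E n) ℂ) x := by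
    refine integral_congr_ae ?_
    filter_upwards [ae_eq_toL2 hgw] with x hx
    rw [hx, mul_comm]
  have e5 : ∫ x, (𝓕 Ψ' : SchwartzMap (E n) ℂ) x * (toL2 u) x =
      ∫ x, (u x : ℂ) * (𝓕 Ψ' : SchwartzMap (E n) ℂ) x := by
    refine integral_congr_ae ?_
    filter_upwards [ae_eq_toL2 hu] with x hx
    rw [hx, mul_comm]
  simp only [hd, mul_neg, integral_neg, neg_inj] at e3
  rw [e4, ← e3, ← e5, ← e2] at e1
  calc _ = _ := e1
    _ = _ := by
      refine integral_congr_ae (ae_of_all _ fun ξ => ?_)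
      change ψ ξ * (2 * Real.pi * Complex.I * ((inner ℝ ξ w : ℝ) : ℂ)) * _ = _
      ring

/-! ### Norms and pairings of square integrable functions -/

theorem Lp_two_norm_sq {F : Type*} [NormedAddCommGroup F] [InnerProductSpace ℝ F]
    (f : Lp F 2 (volume : Measure (E n))) : ‖f‖ ^ 2 = ∫ x, ‖f x‖ ^ 2 := by
  rw [← real_inner_self_eq_norm_sq, L2.inner_def]
  simp only [real_inner_self_eq_norm_sq]

theorem norm_sq_toLp {F : Type*} [NormedAddCommGroup F] [InnerProductSpace ℝ F]
    {f : E n → F} (hf : MemLp f 2 volume) : ‖hf.toLp f‖ ^ 2 = ∫ x, ‖f x‖ ^ 2 := by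
  rw [Lp_two_norm_sq]
  refine integral_congr_ae ?_
  filter_upwards [hf.coeFn_toLp] with x hx
  rw [hx]

theorem integrable_norm_sq {F : Type*} [NormedAddCommGroup F] {f : E n → F}
    (hf : MemLp f 2 volume) : Integrable (fun x => ‖f x‖ ^ 2) volume :=
  (memLp_two_iff_integrable_sq_norm hf.1).1 hf

theorem norm_toL2_sq {u : E n → ℝ} (hu : MemLp u 2 volume) : ‖toL2 u‖ ^ 2 = ∫ x, u x ^ 2 := by
  rw [toL2, dif_pos hu, norm_sq_toLp]
  refine integral_congr_ae (ae_of_all _ fun x => ?_)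
  simp

theorem integrable_mul_of_memLp_two {f g : E n → ℝ} (hf : MemLp f 2 volume)
    (hg : MemLp g 2 volume) : Integrable (fun x => f x * g x) volume :=
  hf.integrable_mul hg

theorem integrable_inner_of_memLp_two {f g : E n → E n} (hf : MemLp f 2 volume)
    (hg : MemLp g 2 volume) : Integrable (fun x => inner ℝ (f x) (g x)) volume := by
  refine (L2.integrable_inner (𝕜 := ℝ) (hf.toLp f) (hg.toLp g)).congr ?_
  filter_upwards [hf.coeFn_toLp, hg.coeFn_toLp] with x h1 h2
  rw [h1, h2]

/-! ### Calculus of weak gradients -/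

theorem HasWeakGrad.congr_ae {u v : E n → ℝ} {g g' : E n → E n} (h : HasWeakGrad u g)
    (huv : u =ᵐ[volume] v) (hg : g =ᵐ[volume] g') : HasWeakGrad v g' := by
  intro η h1 h2 w
  have e1 : ∫ x, v x * fderiv ℝ η x w = ∫ x, u x * fderiv ℝ η x w := by
    refine integral_congr_ae ?_
    filter_upwards [huv] with x hx
    rw [hx]
  have e2 : ∫ x, inner ℝ (g' x) w * η x = ∫ x, inner ℝ (g x) w * η x := by
    refine integral_congr_ae ?_
    filter_upwards [hg] with x hx
    rw [hx]
  rw [e1, e2, h η h1 h2 w]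

theorem memLp_two_fderiv_apply {η : E n → ℝ} (h1 : ContDiff ℝ ∞ η) (h2 : HasCompactSupport η)
    (w : E n) : MemLp (fun x => fderiv ℝ η x w) 2 volume := by
  refine Continuous.memLp_of_hasCompactSupport ?_ ?_
  · exact (h1.continuous_fderiv (by simp)).clm_apply continuous_const
  · exact (h2.fderiv ℝ).comp_left (g := fun L : E n →L[ℝ] ℝ => L w) rfl

theorem HasWeakGrad.add {u v : E n → ℝ} {g g' : E n → E n} (hu : MemLp u 2 volume)
    (hv : MemLp v 2 volume) (hg : MemLp g 2 volume) (hg' : MemLp g' 2 volume)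
    (h : HasWeakGrad u g) (h' : HasWeakGrad v g') :
    HasWeakGrad (fun x => u x + v x) (fun x => g x + g' x) := by
  intro η h1 h2 w
  have d := memLp_two_fderiv_apply h1 h2 w
  have d' : MemLp η 2 volume := h1.continuous.memLp_of_hasCompactSupport h2
  simp only [add_mul, inner_add_left]
  rw [integral_add (integrable_mul_of_memLp_two hu d) (integrable_mul_of_memLp_two hv d),
    integral_add (integrable_mul_of_memLp_two (hg.inner_const w) d')
      (integrable_mul_of_memLp_two (hg'.inner_const w) d'),
    h η h1 h2 w, h' η h1 h2 w, neg_add]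

theorem HasWeakGrad.const_mul {u : E n → ℝ} {g : E n → E n} (h : HasWeakGrad u g) (r : ℝ) :
    HasWeakGrad (fun x => r * u x) (fun x => r • g x) := by
  intro η h1 h2 w
  simp only [mul_assoc, real_inner_smul_left, integral_const_mul]
  rw [h η h1 h2 w, mul_neg]

theorem HasWeakGrad.translate {u : E n → ℝ} {g : E n → E n} (h : HasWeakGrad u g) (y : E n) :
    HasWeakGrad (fun x => u (x + y)) (fun x => g (x + y)) := by
  intro η h1 h2 w
  have hη : ContDiff ℝ ∞ fun x => η (x - y) := h1.comp (contDiff_id.sub contDiff_const)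
  have hc : HasCompactSupport fun x => η (x - y) :=
    h2.comp_homeomorph (Homeomorph.subRight y)
  have := h _ hη hc w
  rw [← integral_add_right_eq_self _ y, ← integral_add_right_eq_self
    (fun x => inner ℝ (g x) w * η (x - y)) y] at this
  simp only [fderiv_comp_sub, add_sub_cancel_right] at this
  exact this

theorem HasWeakGrad.ae_unique {u : E n → ℝ} {g g' : E n → E n} (hg : MemLp g 2 volume)
    (hg' : MemLp g' 2 volume) (h : HasWeakGrad u g) (h' : HasWeakGrad u g') :
    g =ᵐ[volume] g' := by
  refine ae_eq_of_integral_contDiff_smul_eq (MemLp.locallyIntegrable_two hg)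
    (MemLp.locallyIntegrable_two hg') fun η h1 h2 => ?_
  have d' : MemLp η 2 volume := h1.continuous.memLp_of_hasCompactSupport h2
  have i1 : Integrable (fun x => η x • g x) volume := memLp_one_iff_integrable.1 (hg.smul d')
  have i2 : Integrable (fun x => η x • g' x) volume := memLp_one_iff_integrable.1 (hg'.smul d')
  refine ext_inner_left ℝ fun w => ?_
  rw [← integral_inner i1, ← integral_inner i2]
  have := (h η h1 h2 w).symm.trans (h' η h1 h2 w)
  rw [neg_inj] at this
  simpa only [real_inner_smul_right, mul_comm (η _), real_inner_comm w] using this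

theorem MemH1.memLp {u : E n → ℝ} (h : MemH1 u) : MemLp u 2 volume := h.1

theorem MemH1.memLp_weakGrad {u : E n → ℝ} (h : MemH1 u) : MemLp (weakGrad u) 2 volume := by
  rw [weakGrad, dif_pos h.2]; exact h.2.choose_spec.1

theorem MemH1.hasWeakGrad {u : E n → ℝ} (h : MemH1 u) : HasWeakGrad u (weakGrad u) := by
  rw [weakGrad, dif_pos h.2]; exact h.2.choose_spec.2

/-- Uniqueness makes the arbitrary choice inside `weakGrad` harmless: any explicit gradient may be
substituted for it. -/
theorem HasWeakGrad.weakGrad_ae_eq {u : E n → ℝ} {g : E n → E n} (hu : MemLp u 2 volume)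
    (hg : MemLp g 2 volume) (h : HasWeakGrad u g) : weakGrad u =ᵐ[volume] g :=
  have hu' : MemH1 u := ⟨hu, g, hg, h⟩
  HasWeakGrad.ae_unique hu'.memLp_weakGrad hg hu'.hasWeakGrad h

theorem MemH1.add {u v : E n → ℝ} (hu : MemH1 u) (hv : MemH1 v) :
    MemH1 fun x => u x + v x :=
  ⟨hu.1.add hv.1, _, hu.memLp_weakGrad.add hv.memLp_weakGrad,
    hu.hasWeakGrad.add hu.1 hv.1 hu.memLp_weakGrad hv.memLp_weakGrad hv.hasWeakGrad⟩

theorem MemH1.const_mul {u : E n → ℝ} (hu : MemH1 u) (r : ℝ) : MemH1 fun x => r * u x :=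
  ⟨hu.1.const_mul r, _, hu.memLp_weakGrad.const_smul r, hu.hasWeakGrad.const_mul r⟩

theorem MemH1.sub {u v : E n → ℝ} (hu : MemH1 u) (hv : MemH1 v) :
    MemH1 fun x => u x - v x := by
  simpa [sub_eq_add_neg] using hu.add (hv.const_mul (-1))

theorem memLp_translate {F : Type*} [NormedAddCommGroup F] {u : E n → F} {p : ENNReal}
    (hu : MemLp u p volume) (y : E n) : MemLp (fun x => u (x + y)) p volume :=
  hu.comp_measurePreserving (measurePreserving_add_right volume y)

theorem MemH1.translate {u : E n → ℝ} (hu : MemH1 u) (y : E n) : MemH1 fun x => u (x + y) :=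
  ⟨memLp_translate hu.1 y, _, memLp_translate hu.memLp_weakGrad y, hu.hasWeakGrad.translate y⟩

/-- Compactly supported smooth functions lie in `H¹`. -/
theorem memH1_of_contDiff {u : E n → ℝ} (h1 : ContDiff ℝ ∞ u) (h2 : HasCompactSupport u) :
    MemH1 u := by
  refine ⟨h1.continuous.memLp_of_hasCompactSupport h2,
    fun x => (InnerProductSpace.toDual ℝ (E n)).symm (fderiv ℝ u x), ?_, ?_⟩
  · refine Continuous.memLp_of_hasCompactSupport ?_ ?_
    · exact (LinearIsometryEquiv.continuous _).comp (h1.continuous_fderiv (by simp))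
    · exact (h2.fderiv ℝ).comp_left (map_zero _)
  · intro η h3 h4 w
    simp only [InnerProductSpace.toDual_symm_apply]
    have d1 := memLp_two_fderiv_apply h1 h2 w
    have d2 := memLp_two_fderiv_apply h3 h4 w
    have m1 : MemLp u 2 volume := h1.continuous.memLp_of_hasCompactSupport h2
    have m2 : MemLp η 2 volume := h3.continuous.memLp_of_hasCompactSupport h4
    exact integral_mul_fderiv_eq_neg_fderiv_mul_of_integrable (d1.integrable_mul m2)
      (m1.integrable_mul d2) (m1.integrable_mul m2) (fun x _ => h1.differentiable (by simp) x)
      (fun x _ => h3.differentiable (by simp) x)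

/-! ### `H¹` inside a Hilbert space -/

/-- The Hilbert space `L²(ℝⁿ) × L²(ℝⁿ; ℝⁿ)` which contains `H¹(ℝⁿ)` through `u ↦ (u, ∇u)`. -/
abbrev Pair (n : ℕ) : Type :=
  WithLp 2 (Lp ℝ 2 (volume : Measure (E n)) × Lp (E n) 2 (volume : Measure (E n)))

open Classical in
/-- The pair `(u, ∇u)` for `u ∈ H¹`. -/
def jet (u : E n → ℝ) : Pair n :=
  if h : MemH1 u then WithLp.toLp 2 (h.memLp.toLp u, h.memLp_weakGrad.toLp (weakGrad u)) else 0

theorem jet_eq {u : E n → ℝ} (h : MemH1 u) :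
    jet u = WithLp.toLp 2 (h.memLp.toLp u, h.memLp_weakGrad.toLp (weakGrad u)) := by
  rw [jet, dif_pos h]

/-- Passing to classes removes the choice of gradient, so sums and multiples of given gradients
compute the jet. This is the source of its linearity. -/
theorem jet_eq_of_hasWeakGrad {u : E n → ℝ} {g : E n → E n} (hu : MemLp u 2 volume)
    (hg : MemLp g 2 volume) (h : HasWeakGrad u g) :
    jet u = WithLp.toLp 2 (hu.toLp u, hg.toLp g) := by
  rw [jet_eq ⟨hu, g, hg, h⟩]
  congr 2
  exact MemLp.toLp_congr _ _ (h.weakGrad_ae_eq hu hg)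

theorem jet_add {u v : E n → ℝ} (hu : MemH1 u) (hv : MemH1 v) :
    jet (fun x => u x + v x) = jet u + jet v := by
  rw [jet_eq_of_hasWeakGrad (u := fun x => u x + v x) (hu.1.add hv.1)
    (hu.memLp_weakGrad.add hv.memLp_weakGrad)
    (hu.hasWeakGrad.add hu.1 hv.1 hu.memLp_weakGrad hv.memLp_weakGrad hv.hasWeakGrad),
    jet_eq hu, jet_eq hv]
  rfl

theorem jet_const_mul {u : E n → ℝ} (hu : MemH1 u) (r : ℝ) :
    jet (fun x => r * u x) = r • jet u := by
  rw [jet_eq_of_hasWeakGrad (hu.1.const_mul r) (hu.memLp_weakGrad.const_smul r)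
    (hu.hasWeakGrad.const_mul r), jet_eq hu]
  rfl

theorem jet_sub {u v : E n → ℝ} (hu : MemH1 u) (hv : MemH1 v) :
    jet (fun x => u x - v x) = jet u - jet v := by
  have := jet_add hu (hv.const_mul (-1))
  rw [jet_const_mul hv, neg_one_smul, ← sub_eq_add_neg] at this
  rw [← this]
  congr 1; ext x; ring

theorem norm_jet_sq {u : E n → ℝ} (h : MemH1 u) :
    ‖jet u‖ ^ 2 = ∫ x, (‖weakGrad u x‖ ^ 2 + u x ^ 2) := by
  have hu := integrable_norm_sq h.1
  simp only [Real.norm_eq_abs, sq_abs] at hu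
  rw [jet_eq h, WithLp.prod_norm_sq_eq_of_L2,
    integral_add (integrable_norm_sq h.memLp_weakGrad) hu, add_comm]
  simp only [WithLp.toLp_fst, WithLp.toLp_snd]
  rw [norm_sq_toLp, norm_sq_toLp]
  simp

theorem norm_jet {u : E n → ℝ} (h : MemH1 u) : ‖jet u‖ = h1Norm u := by
  rw [h1Norm, ← norm_jet_sq h, Real.sqrt_sq (norm_nonneg _)]

theorem inner_jet {u v : E n → ℝ} (hu : MemH1 u) (hv : MemH1 v) :
    inner ℝ (jet u) (jet v) =
      ∫ x, (u x * v x + inner ℝ (weakGrad u x) (weakGrad v x)) := by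
  rw [jet_eq hu, jet_eq hv, WithLp.prod_inner_apply, L2.inner_def, L2.inner_def,
    integral_add (integrable_mul_of_memLp_two hu.1 hv.1)
      (integrable_inner_of_memLp_two hu.memLp_weakGrad hv.memLp_weakGrad)]
  congr 1
  · refine integral_congr_ae ?_
    filter_upwards [hu.memLp.coeFn_toLp, hv.memLp.coeFn_toLp] with x h1 h2
    rw [h1, h2]; simp [mul_comm]
  · refine integral_congr_ae ?_
    filter_upwards [hu.memLp_weakGrad.coeFn_toLp, hv.memLp_weakGrad.coeFn_toLp] with x h1 h2
    rw [h1, h2]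

theorem norm_jet_translate {u : E n → ℝ} (h : MemH1 u) (y : E n) :
    ‖jet fun x => u (x + y)‖ = ‖jet u‖ := by
  rw [← sq_eq_sq₀ (norm_nonneg _) (norm_nonneg _), norm_jet_sq h, norm_jet_sq (h.translate y),
    ← integral_add_right_eq_self (fun x => ‖weakGrad u x‖ ^ 2 + u x ^ 2) y]
  refine integral_congr_ae ?_
  filter_upwards [(h.hasWeakGrad.translate y).weakGrad_ae_eq (memLp_translate h.1 y)
    (memLp_translate h.memLp_weakGrad y)] with x hx
  rw [hx]

theorem norm_le_norm_jet {u : E n → ℝ} (h : MemH1 u) : ‖toL2 u‖ ≤ ‖jet u‖ := by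
  rw [← sq_le_sq₀ (norm_nonneg _) (norm_nonneg _), norm_toL2_sq h.1, norm_jet_sq h]
  have hu := integrable_norm_sq h.1
  simp only [Real.norm_eq_abs, sq_abs] at hu
  refine integral_mono hu ((integrable_norm_sq h.memLp_weakGrad).add hu) fun x => ?_
  simp only [le_add_iff_nonneg_left]
  positivity

/-- The first components of weakly convergent jets determine functions in `H¹`: the image of `H¹`
is weakly sequentially closed. -/
theorem exists_jet_eq_of_tendsto_inner {u : ℕ → E n → ℝ} (hu : ∀ k, MemH1 (u k)) {z : Pair n}
    (hz : ∀ h : Pair n, Tendsto (fun k => inner ℝ h (jet (u k))) atTop (𝓝 (inner ℝ h z))) :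
    ∃ φ : E n → ℝ, MemH1 φ ∧ jet φ = z := by
  have hw : HasWeakGrad (z.fst : E n → ℝ) (z.snd : E n → E n) := by
    intro η h1 h2 w
    have d1 := memLp_two_fderiv_apply h1 h2 w
    have d2 : MemLp (fun x => η x • w) 2 volume := by
      refine Continuous.memLp_of_hasCompactSupport (h1.continuous.smul continuous_const) ?_
      exact h2.comp_left (g := fun t : ℝ => t • w) (zero_smul _ _)
    -- Pairing with (∂_w η, η w) encodes the defining identity: a pair consists of a function and
    -- its weak gradient exactly when all such pairings vanish, a condition closed under weak
    -- limits.
    let h : Pair n := WithLp.toLp 2 (d1.toLp _, d2.toLp _)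
    have e : ∀ q : Pair n, inner ℝ h q =
        (∫ x, (q.fst : E n → ℝ) x * fderiv ℝ η x w) +
          ∫ x, inner ℝ ((q.snd : E n → E n) x) w * η x := fun q => by
      rw [WithLp.prod_inner_apply, L2.inner_def, L2.inner_def]
      congr 1
      · refine integral_congr_ae ?_
        filter_upwards [d1.coeFn_toLp] with x h1
        rw [h1]; simp
      · refine integral_congr_ae ?_
        filter_upwards [d2.coeFn_toLp] with x h1
        rw [h1, real_inner_smul_left, real_inner_comm, mul_comm]; rfl
    have e0 : ∀ k, inner ℝ h (jet (u k)) = 0 := fun k => by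
      have h3 : HasWeakGrad ((jet (u k)).fst : E n → ℝ) ((jet (u k)).snd : E n → E n) := by
        rw [jet_eq (hu k)]
        exact (hu k).hasWeakGrad.congr_ae (hu k).1.coeFn_toLp.symm
          (hu k).memLp_weakGrad.coeFn_toLp.symm
      rw [e, h3 η h1 h2 w, neg_add_cancel]
    have := hz h
    simp only [e0] at this
    have h4 := tendsto_nhds_unique tendsto_const_nhds this
    rw [e] at h4
    linarith
  refine ⟨z.fst, ⟨Lp.memLp _, _, Lp.memLp _, hw⟩, ?_⟩
  rw [jet_eq_of_hasWeakGrad (Lp.memLp _) (Lp.memLp _) hw]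
  simp only [Lp.toLp_coeFn]
  rfl

/-- Bounded sequences in a separable Hilbert space have weakly convergent subsequences. -/
theorem exists_subseq_tendsto_inner {H : Type*} [NormedAddCommGroup H] [InnerProductSpace ℝ H]
    [CompleteSpace H] [TopologicalSpace.SeparableSpace H] {x : ℕ → H} {M : ℝ}
    (hx : ∀ k, ‖x k‖ ≤ M) :
    ∃ (z : H) (k : ℕ → ℕ), StrictMono k ∧
      ∀ h : H, Tendsto (fun j => inner ℝ h (x (k j))) atTop (𝓝 (inner ℝ h z)) := by
  have hmem : ∀ k, StrongDual.toWeakDual (InnerProductSpace.toDual ℝ H (x k)) ∈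
      WeakDual.toStrongDual ⁻¹' Metric.closedBall (0 : StrongDual ℝ H) M := fun k => by
    simpa using hx k
  obtain ⟨a, -, k, hk, hlim⟩ := WeakDual.isSeqCompact_closedBall ℝ H 0 M hmem
  refine ⟨(InnerProductSpace.toDual ℝ H).symm (WeakDual.toStrongDual a), k, hk, fun h => ?_⟩
  have := ((WeakBilin.eval_continuous (topDualPairing ℝ H) h).tendsto a).comp hlim
  have e : inner ℝ h ((InnerProductSpace.toDual ℝ H).symm (WeakDual.toStrongDual a)) = a h := by
    rw [real_inner_comm, InnerProductSpace.toDual_symm_apply]; rfl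
  rw [e]
  refine this.congr fun j => ?_
  rw [real_inner_comm]
  rfl

/-- Separability is what permits extracting sequences, rather than nets, in the Banach–Alaoglu
theorem. -/
instance Pair.separableSpace : TopologicalSpace.SeparableSpace (Pair n) := by
  have : Fact ((2 : ENNReal) ≠ ⊤) := ⟨by norm_num⟩
  have h : TopologicalSpace.SeparableSpace
    (Lp ℝ 2 (volume : Measure (E n)) × Lp (E n) 2 (volume : Measure (E n))) := by
    have h1 : SecondCountableTopology (Lp ℝ 2 (volume : Measure (E n))) := Lp.SecondCountableTopology
    have h2 : SecondCountableTopology (Lp (E n) 2 (volume : Measure (E n))) :=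
      Lp.SecondCountableTopology
    infer_instance
  exact (WithLp.homeomorphProd 2 _ _).symm.isQuotientMap.separableSpace

/-! ### Frequency truncation -/

theorem memLp_indicator_fourier (A : ℝ) (f : L2C n) :
    MemLp ((Metric.ball (0 : E n) A).indicator (𝓕 f : L2C n)) 2 volume :=
  (Lp.memLp (𝓕 f : L2C n)).indicator Metric.isOpen_ball.measurableSet

/-- The part of `f ∈ L²` with frequencies `|ξ| < A`. -/
def low (A : ℝ) (f : L2C n) : L2C n :=
  𝓕⁻ ((memLp_indicator_fourier A f).toLp _ : L2C n)

theorem fourier_low (A : ℝ) (f : L2C n) :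
    ((𝓕 (low A f) : L2C n) : E n → ℂ) =ᵐ[volume]
      (Metric.ball (0 : E n) A).indicator (𝓕 f : L2C n) := by
  rw [low, FourierTransform.fourier_fourierInv_eq]
  exact MemLp.coeFn_toLp _

theorem measure_ball_ne_top (A : ℝ) : volume (Metric.ball (0 : E n) A) ≠ ⊤ :=
  Metric.isBounded_ball.measure_lt_top.ne

theorem memLp_lowKernel (A : ℝ) (y : E n) :
    MemLp ((Metric.ball (0 : E n) A).indicator
      fun ξ => (Real.fourierChar (-inner ℝ ξ y) : ℂ)) 2 volume := by
  have h : Continuous fun ξ : E n => (Real.fourierChar (-inner ℝ ξ y) : ℂ) :=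
    continuous_subtype_val.comp (Real.continuous_fourierChar.comp
      (continuous_id.inner continuous_const).neg)
  refine (memLp_indicator_const 2 (Metric.isOpen_ball.measurableSet) (1 : ℂ)
    (Or.inr (measure_ball_ne_top A))).of_le
    (h.aestronglyMeasurable.indicator Metric.isOpen_ball.measurableSet) (ae_of_all _ fun ξ => ?_)
  by_cases h : ξ ∈ Metric.ball (0 : E n) A
  · rw [Set.indicator_of_mem h, Set.indicator_of_mem h, Circle.norm_coe, norm_one]
  · simp [Set.indicator_of_notMem h]

/-- The frequency side of the kernel which evaluates the low frequency part at `y`. -/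
def lowKernel (A : ℝ) (y : E n) : L2C n := (memLp_lowKernel A y).toLp _

/-- The low frequency part as a continuous function. -/
def lowFun (A : ℝ) (f : L2C n) (y : E n) : ℂ := inner ℂ (lowKernel A y) (𝓕 f : L2C n)

theorem lowFun_eq_integral (A : ℝ) (f : L2C n) (y : E n) :
    lowFun A f y = ∫ ξ in Metric.ball (0 : E n) A,
      (Real.fourierChar (inner ℝ ξ y) : ℂ) * (𝓕 f : L2C n) ξ := by
  rw [lowFun, L2.inner_def, ← integral_indicator Metric.isOpen_ball.measurableSet]
  refine integral_congr_ae ?_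
  filter_upwards [(memLp_lowKernel A y).coeFn_toLp] with ξ hξ
  rw [lowKernel, hξ]
  by_cases h : ξ ∈ Metric.ball (0 : E n) A
  · simp only [Set.indicator_of_mem h, RCLike.inner_apply]
    rw [AddChar.map_neg_eq_inv, Circle.coe_inv_eq_conj, Complex.conj_conj, mul_comm]
  · simp [Set.indicator_of_notMem h]

theorem norm_lowKernel (A : ℝ) (y : E n) :
    ‖lowKernel A y‖ = Real.sqrt (volume.real (Metric.ball (0 : E n) A)) := by
  rw [← Real.sqrt_sq (norm_nonneg (lowKernel A y)), lowKernel, norm_sq_toLp]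
  congr 1
  have : ∀ ξ, ‖(Metric.ball (0 : E n) A).indicator
      (fun ξ => (Real.fourierChar (-inner ℝ ξ y) : ℂ)) ξ‖ ^ 2 =
      (Metric.ball (0 : E n) A).indicator (fun _ => (1 : ℝ)) ξ := fun ξ => by
    by_cases h : ξ ∈ Metric.ball (0 : E n) A
    · rw [Set.indicator_of_mem h, Set.indicator_of_mem h, Circle.norm_coe, one_pow]
    · simp [Set.indicator_of_notMem h]
  simp only [this]
  rw [integral_indicator Metric.isOpen_ball.measurableSet]
  simp

/-- Cauchy–Schwarz against a kernel whose norm does not depend on the point, which makes the bound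
uniform in space. -/
theorem norm_lowFun_le (A : ℝ) (f : L2C n) (y : E n) :
    ‖lowFun A f y‖ ≤ Real.sqrt (volume.real (Metric.ball (0 : E n) A)) * ‖f‖ := by
  rw [← norm_lowKernel A y, ← Lp.norm_fourier_eq f]
  exact norm_inner_le_norm _ _

/-- On a ball of finite measure L² is contained in L¹, so the inverse transform of the truncation is
an honest integral. -/
theorem low_ae_eq_lowFun (A : ℝ) (f : L2C n) :
    (low A f : E n → ℂ) =ᵐ[volume] lowFun A f := by
  have h1 : Integrable ((Metric.ball (0 : E n) A).indicator (𝓕 f : L2C n)) volume := by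
    rw [integrable_indicator_iff Metric.isOpen_ball.measurableSet]
    have : IsFiniteMeasure (volume.restrict (Metric.ball (0 : E n) A)) :=
      ⟨by simpa using Metric.isBounded_ball.measure_lt_top⟩
    exact ((Lp.memLp (𝓕 f : L2C n)).restrict _).integrable one_le_two
  filter_upwards [fourierInv_toLp_ae_eq h1 (memLp_indicator_fourier A f)] with y hy
  rw [low, hy, lowFun_eq_integral, Real.fourierInv_eq,
    ← integral_indicator Metric.isOpen_ball.measurableSet]
  refine integral_congr_ae (ae_of_all _ fun ξ => ?_)
  by_cases h : ξ ∈ Metric.ball (0 : E n) A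
  · simp [Set.indicator_of_mem h, Circle.smul_def]
  · simp [Set.indicator_of_notMem h]

/-- Because the low frequency part is defined by an integral, translation acts on it at every point.
This allows a chosen point to be moved to the origin. -/
theorem lowFun_translate {f g : L2C n} {y : E n}
    (hfg : (g : E n → ℂ) =ᵐ[volume] fun x => f (x + y)) (A : ℝ) (x : E n) :
    lowFun A g x = lowFun A f (x + y) := by
  rw [lowFun_eq_integral, lowFun_eq_integral]
  refine integral_congr_ae (ae_restrict_of_ae ?_)
  filter_upwards [fourier_translate_ae_eq hfg] with ξ hξ
  rw [hξ, inner_add_right, AddChar.map_add_eq_mul]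
  push_cast
  ring

theorem fourier_sub (f g : L2C n) : (𝓕 (f - g) : L2C n) = 𝓕 f - 𝓕 g := by
  rw [sub_eq_add_neg, FourierTransform.fourier_add, FourierTransform.fourier_neg, ← sub_eq_add_neg]

theorem lowFun_sub (A : ℝ) (f g : L2C n) (y : E n) :
    lowFun A (f - g) y = lowFun A f y - lowFun A g y := by
  rw [lowFun, fourier_sub, inner_sub_right]; rfl

/-- Bernstein's inequality. -/
theorem ae_norm_le_of_fourier_support {f : L2C n} {A : ℝ}
    (h : ∀ᵐ ξ, ξ ∉ Metric.ball (0 : E n) A → (𝓕 f : L2C n) ξ = 0) :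
    ∀ᵐ x, ‖f x‖ ≤ Real.sqrt (volume.real (Metric.ball (0 : E n) A)) * ‖f‖ := by
  have e : low A f = f := by
    rw [low]
    have : (memLp_indicator_fourier A f).toLp _ = (𝓕 f : L2C n) := by
      refine Lp.ext ((MemLp.coeFn_toLp _).trans ?_)
      filter_upwards [h] with ξ hξ
      by_cases hm : ξ ∈ Metric.ball (0 : E n) A
      · rw [Set.indicator_of_mem hm]
      · rw [Set.indicator_of_notMem hm, hξ hm]
    rw [this, FourierTransform.fourierInv_fourier_eq]
  have := low_ae_eq_lowFun A f
  rw [e] at this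
  filter_upwards [this] with x hx
  rw [hx]
  exact norm_lowFun_le A f x

/-- The Fourier side of the `H¹` norm. -/
theorem integral_norm_mul_fourier {u : E n → ℝ} (hu : MemH1 u) :
    Integrable (fun ξ => (2 * Real.pi) ^ 2 * (‖ξ‖ ^ 2 * ‖(𝓕 (toL2 u) : L2C n) ξ‖ ^ 2)) volume ∧
    ∫ ξ, (2 * Real.pi) ^ 2 * (‖ξ‖ ^ 2 * ‖(𝓕 (toL2 u) : L2C n) ξ‖ ^ 2) =
      ∫ x, ‖weakGrad u x‖ ^ 2 := by
  let e : Fin n → E n := fun i => EuclideanSpace.basisFun (Fin n) ℝ i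
  let G : Fin n → L2C n := fun i => toL2 fun x => inner ℝ (weakGrad u x) (e i)
  have hm : ∀ i, MemLp (fun x => inner ℝ (weakGrad u x) (e i)) 2 volume :=
    fun i => hu.memLp_weakGrad.inner_const _
  have hs : ∀ v : E n, ∑ i, inner ℝ v (e i) ^ 2 = ‖v‖ ^ 2 := fun v => by
    rw [EuclideanSpace.norm_sq_eq]
    refine Finset.sum_congr rfl fun i _ => ?_
    simp [e, EuclideanSpace.inner_single_right]
  have h1 : (fun ξ => (2 * Real.pi) ^ 2 * (‖ξ‖ ^ 2 * ‖(𝓕 (toL2 u) : L2C n) ξ‖ ^ 2)) =ᵐ[volume]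
      fun ξ => ∑ i, ‖(𝓕 (G i) : L2C n) ξ‖ ^ 2 := by
    have := ae_all_iff.2 fun i => hu.hasWeakGrad.fourier_ae_eq hu.memLp hu.memLp_weakGrad (e i)
    filter_upwards [this] with ξ hξ
    simp only [G, hξ, norm_mul, mul_pow, Complex.norm_real, Complex.norm_I, Real.norm_eq_abs,
      sq_abs, Complex.norm_ofNat]
    rw [← Finset.sum_mul, ← Finset.mul_sum, hs]
    ring
  have h2 : ∀ i, Integrable (fun ξ => ‖(𝓕 (G i) : L2C n) ξ‖ ^ 2) volume :=
    fun i => integrable_norm_sq (Lp.memLp _)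
  refine ⟨(integrable_finsetSum _ fun i _ => h2 i).congr h1.symm, ?_⟩
  rw [integral_congr_ae h1, integral_finsetSum _ fun i _ => h2 i]
  simp only [← Lp_two_norm_sq, Lp.norm_fourier_eq]
  simp only [G]
  simp_rw [norm_toL2_sq (hm _)]
  rw [← integral_finsetSum _ fun i _ => by simpa using integrable_norm_sq (hm i)]
  simp only [hs]

/-- A function whose Fourier transform is that of `u ∈ H¹` cut to high frequencies is small. -/
theorem norm_le_of_fourier_high {u : E n → ℝ} (hu : MemH1 u) {A : ℝ} (hA : 0 < A) {h : L2C n}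
    (hle : ∀ᵐ ξ, ‖(𝓕 h : L2C n) ξ‖ ≤ ‖(𝓕 (toL2 u) : L2C n) ξ‖)
    (hz : ∀ᵐ ξ, ξ ∈ Metric.ball (0 : E n) A → (𝓕 h : L2C n) ξ = 0) :
    ‖h‖ ≤ ‖jet u‖ / A := by
  rw [le_div_iff₀ hA, ← sq_le_sq₀ (by positivity) (norm_nonneg _), mul_pow, ← Lp.norm_fourier_eq,
    Lp_two_norm_sq, ← integral_mul_const]
  obtain ⟨hi, he⟩ := integral_norm_mul_fourier hu
  have hu2 : ∫ x, ‖weakGrad u x‖ ^ 2 ≤ ‖jet u‖ ^ 2 := by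
    have hu' := integrable_norm_sq hu.memLp
    simp only [Real.norm_eq_abs, sq_abs] at hu'
    rw [norm_jet_sq hu]
    refine integral_mono (integrable_norm_sq hu.memLp_weakGrad)
      ((integrable_norm_sq hu.memLp_weakGrad).add hu') fun x => ?_
    simp only [le_add_iff_nonneg_right]
    positivity
  refine le_trans ?_ hu2
  rw [← he]
  refine integral_mono_ae ((integrable_norm_sq (Lp.memLp _)).mul_const _) hi ?_
  filter_upwards [hle, hz] with ξ h1 h2
  by_cases hm : ξ ∈ Metric.ball (0 : E n) A
  · simp only [h2 hm, norm_zero]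
    rw [zero_pow two_ne_zero, zero_mul]
    positivity
  · have h3 : A ≤ ‖ξ‖ := by simpa using hm
    -- The factor (2π)² comes from the normalization of the Fourier transform; it is at least 1 and
    -- is simply dropped.
    have h4 : (1 : ℝ) ≤ (2 * Real.pi) ^ 2 := one_le_pow₀ (by linarith [Real.two_le_pi])
    calc ‖(𝓕 h : L2C n) ξ‖ ^ 2 * A ^ 2 ≤ ‖(𝓕 (toL2 u) : L2C n) ξ‖ ^ 2 * ‖ξ‖ ^ 2 := by gcongr
      _ = 1 * (‖ξ‖ ^ 2 * ‖(𝓕 (toL2 u) : L2C n) ξ‖ ^ 2) := by ring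
      _ ≤ _ := mul_le_mul_of_nonneg_right h4 (by positivity)

theorem fourier_sub_ae (f g : L2C n) : ((𝓕 (f - g) : L2C n) : E n → ℂ) =ᵐ[volume]
    fun ξ => (𝓕 f : L2C n) ξ - (𝓕 g : L2C n) ξ := by
  rw [fourier_sub]
  exact Lp.coeFn_sub _ _

theorem norm_sub_low_le {u : E n → ℝ} (hu : MemH1 u) {A : ℝ} (hA : 0 < A) :
    ‖toL2 u - low A (toL2 u)‖ ≤ ‖jet u‖ / A := by
  refine norm_le_of_fourier_high hu hA ?_ ?_
  · filter_upwards [fourier_sub_ae (toL2 u) (low A (toL2 u)), fourier_low A (toL2 u)] with ξ h1 h2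
    rw [h1, h2]
    by_cases hm : ξ ∈ Metric.ball (0 : E n) A
    · simp [Set.indicator_of_mem hm]
    · simp [Set.indicator_of_notMem hm]
  · filter_upwards [fourier_sub_ae (toL2 u) (low A (toL2 u)), fourier_low A (toL2 u)] with ξ h1 h2
    intro hm
    rw [h1, h2, Set.indicator_of_mem hm, sub_self]

theorem fourier_low_sub_low {A B : ℝ} (f : L2C n) (hAB : A ≤ B) :
    ((𝓕 (low B f - low A f) : L2C n) : E n → ℂ) =ᵐ[volume]
      (Metric.ball (0 : E n) B \ Metric.ball (0 : E n) A).indicator (𝓕 f : L2C n) := by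
  filter_upwards [fourier_sub_ae (low B f) (low A f), fourier_low A f, fourier_low B f]
    with ξ h1 h2 h3
  rw [h1, h2, h3, Set.indicator_sdiff (Metric.ball_subset_ball hAB)]
  rfl

theorem norm_low_sub_low_le {u : E n → ℝ} (hu : MemH1 u) {A B : ℝ} (hA : 0 < A) (hAB : A ≤ B) :
    ‖low B (toL2 u) - low A (toL2 u)‖ ≤ ‖jet u‖ / A := by
  refine norm_le_of_fourier_high hu hA ?_ ?_
  · filter_upwards [fourier_low_sub_low (toL2 u) hAB] with ξ h1
    rw [h1]
    exact norm_indicator_le_norm_self _ _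
  · filter_upwards [fourier_low_sub_low (toL2 u) hAB] with ξ h1
    intro hm
    rw [h1, Set.indicator_of_notMem]
    simp [hm]

theorem ae_norm_low_sub_low_le (f : L2C n) {A B : ℝ} (hAB : A ≤ B) :
    ∀ᵐ x, ‖(low B f - low A f) x‖ ≤
      Real.sqrt (volume.real (Metric.ball (0 : E n) B)) * ‖low B f - low A f‖ := by
  refine ae_norm_le_of_fourier_support ?_
  filter_upwards [fourier_low_sub_low f hAB] with ξ h1
  intro hm
  rw [h1, Set.indicator_of_notMem]
  simp only [Set.mem_sdiff, not_and]
  exact fun h => absurd h hm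

theorem norm_low_le (A : ℝ) (f : L2C n) : ‖low A f‖ ≤ ‖f‖ := by
  rw [← sq_le_sq₀ (norm_nonneg _) (norm_nonneg _), ← Lp.norm_fourier_eq, ← Lp.norm_fourier_eq f,
    Lp_two_norm_sq, Lp_two_norm_sq]
  refine integral_mono_ae (integrable_norm_sq (Lp.memLp _)) (integrable_norm_sq (Lp.memLp _)) ?_
  filter_upwards [fourier_low A f] with ξ h
  rw [h]
  exact pow_le_pow_left₀ (norm_nonneg _) (norm_indicator_le_norm_self _ _) 2

/-! ### Dyadic decomposition, the subcritical Sobolev embedding and vanishing -/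

/-- Interpolation between `L²` and `L^∞`. -/
theorem eLpNorm_le_of_ae_norm_le {f : L2C n} {b r : ℝ} (hr : 2 < r) (hb : ∀ᵐ x, ‖f x‖ ≤ b)
    (hb0 : 0 ≤ b) :
    eLpNorm f (ENNReal.ofReal r) volume ≤ ENNReal.ofReal (b ^ (1 - 2 / r) * ‖f‖ ^ (2 / r)) := by
  have hr0 : 0 < r := by linarith
  have h2 : ∫⁻ x, ‖f x‖ₑ ^ (2 : ℝ) = ENNReal.ofReal (‖f‖ ^ 2) := by
    have h := eLpNorm_eq_lintegral_rpow_enorm_toReal (μ := volume) (f := (f : E n → ℂ))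
      (two_ne_zero) (ENNReal.ofNat_ne_top (n := 2))
    have h3 : eLpNorm f 2 volume = ENNReal.ofReal ‖f‖ := by
      rw [Lp.norm_def, ENNReal.ofReal_toReal (Lp.eLpNorm_ne_top f)]
    rw [h3] at h
    simp only [ENNReal.toReal_ofNat] at h
    rw [ENNReal.ofReal_pow (norm_nonneg _), h, ← ENNReal.rpow_natCast, ← ENNReal.rpow_mul]
    norm_num
  -- Pointwise |f|^r ≤ b^(r−2) |f|².
  have h1 : ∫⁻ x, ‖f x‖ₑ ^ r ≤ ENNReal.ofReal (b ^ (r - 2) * ‖f‖ ^ 2) := by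
    rw [ENNReal.ofReal_mul (by positivity), ← h2, ← lintegral_const_mul' _ _ ENNReal.ofReal_ne_top]
    refine lintegral_mono_ae ?_
    filter_upwards [hb] with x hx
    have e : r = (r - 2) + 2 := by ring
    conv_lhs => rw [e]
    rw [ENNReal.rpow_add_of_nonneg _ _ (by linarith) (by norm_num)]
    gcongr
    rw [← ENNReal.ofReal_rpow_of_nonneg hb0 (by linarith)]
    refine ENNReal.rpow_le_rpow ?_ (by linarith)
    rw [← ofReal_norm]
    exact ENNReal.ofReal_le_ofReal hx
  rw [eLpNorm_eq_lintegral_rpow_enorm_toReal (by simpa using hr0) ENNReal.ofReal_ne_top,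
    ENNReal.toReal_ofReal hr0.le]
  calc _ ≤ (ENNReal.ofReal (b ^ (r - 2) * ‖f‖ ^ 2)) ^ (1 / r) :=
        ENNReal.rpow_le_rpow h1 (by positivity)
    _ = _ := by
      rw [ENNReal.ofReal_rpow_of_nonneg (by positivity) (by positivity),
        Real.mul_rpow (by positivity) (by positivity), ← Real.rpow_mul hb0, ← Real.rpow_natCast,
        ← Real.rpow_mul (norm_nonneg _)]
      congr 3
      · field_simp
      · push_cast; ring


theorem volume_real_ball_two_pow (j : ℕ) :
    volume.real (Metric.ball (0 : E n) (2 ^ j)) =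
      (2 ^ n) ^ j * volume.real (Metric.ball (0 : E n) 1) := by
  have := Measure.addHaar_ball_mul_of_pos (volume : Measure (E n)) 0
    (show (0 : ℝ) < 2 ^ j by positivity) 1
  rw [mul_one] at this
  rw [measureReal_def, this, ENNReal.toReal_mul, ENNReal.toReal_ofReal (by positivity),
    finrank_euclideanSpace_fin, ← pow_mul, ← pow_mul, mul_comm j n]
  rfl

/-- High frequencies are uniformly small in the subcritical spaces `L^r`. -/
theorem exists_eLpNorm_sub_low_le {r : ℝ} (hr : 2 < r) (hs : n * (1 / 2 - 1 / r) < 1) :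
    ∃ C q : ℝ, 0 ≤ C ∧ 0 ≤ q ∧ q < 1 ∧ ∀ u : E n → ℝ, MemH1 u → ∀ j : ℕ,
      eLpNorm (toL2 u - low (2 ^ j) (toL2 u) : L2C n) (ENNReal.ofReal r) volume ≤
        ENNReal.ofReal (C * q ^ j * ‖jet u‖) := by
  have hr0 : 0 < r := by linarith
  have h1r : 0 ≤ 1 - 2 / r := by
    rw [sub_nonneg, div_le_one hr0]; exact hr.le
  set V : ℝ := volume.real (Metric.ball (0 : E n) 1)
  -- For the block of frequencies between 2^i and 2^(i+1), Bernstein and interpolation cost D s^i,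
  -- while the gradient bound gains 2^(−i). The ratio of the resulting geometric series is q = s/2,
  -- and s = 2^(n(1/2 − 1/r)) < 2 is precisely subcriticality.
  set D : ℝ := Real.sqrt (2 ^ n * V) ^ (1 - 2 / r)
  set s : ℝ := Real.sqrt (2 ^ n) ^ (1 - 2 / r)
  set q : ℝ := s / 2
  have hs0 : 0 ≤ s := by positivity
  have hq0 : 0 ≤ q := by positivity
  have hq1 : q < 1 := by
    have : s = 2 ^ (n * (1 / 2 - 1 / r)) := by
      simp only [s]
      rw [Real.sqrt_eq_rpow, ← Real.rpow_natCast, ← Real.rpow_mul (by norm_num),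
        ← Real.rpow_mul (by norm_num)]
      congr 1
      field_simp
    have h2 : s < 2 ^ (1 : ℝ) := by
      rw [this]
      exact Real.rpow_lt_rpow_of_exponent_lt one_lt_two hs
    rw [Real.rpow_one] at h2
    simp only [q]; linarith
  have hrE : (1 : ENNReal) ≤ ENNReal.ofReal r := by
    rw [← ENNReal.ofReal_one]; exact ENNReal.ofReal_le_ofReal (by linarith)
  refine ⟨D / (1 - q), q, by have : 0 < 1 - q := by linarith
                             positivity, hq0, hq1, fun u hu j => ?_⟩
  set f := toL2 u
  set N := ‖jet u‖
  have step : ∀ i : ℕ, eLpNorm (low (2 ^ (i + 1)) f - low (2 ^ i) f : L2C n) (ENNReal.ofReal r)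
      volume ≤ ENNReal.ofReal (D * q ^ i * N) := fun i => by
    have hle : (2 : ℝ) ^ i ≤ 2 ^ (i + 1) := pow_le_pow_right₀ one_le_two (Nat.le_succ i)
    refine (eLpNorm_le_of_ae_norm_le hr (ae_norm_low_sub_low_le f hle)
      (by positivity)).trans (ENNReal.ofReal_le_ofReal ?_)
    have hd := norm_low_sub_low_le hu (show (0 : ℝ) < 2 ^ i by positivity) hle
    set δ := ‖low (2 ^ (i + 1)) f - low (2 ^ i) f‖
    have hδ : 0 ≤ δ := norm_nonneg _
    have e1 : Real.sqrt (volume.real (Metric.ball (0 : E n) (2 ^ (i + 1)))) ^ (1 - 2 / r) =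
        D * s ^ i := by
      rw [volume_real_ball_two_pow, pow_succ, mul_assoc, mul_comm, Real.sqrt_mul (by positivity),
        Real.mul_rpow (by positivity) (by positivity)]
      congr 1
      simp only [s]
      rw [Real.rpow_pow_comm (by positivity)]
      congr 1
      rw [Real.sqrt_eq_iff_mul_self_eq (by positivity) (by positivity), ← mul_pow,
        Real.mul_self_sqrt (by positivity)]
    rw [Real.mul_rpow (by positivity) hδ, e1, mul_assoc, ← Real.rpow_add_of_nonneg hδ h1r
      (by positivity), sub_add_cancel, Real.rpow_one]
    calc D * s ^ i * δ ≤ D * s ^ i * (N / 2 ^ i) := by gcongr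
      _ = _ := by simp only [q, div_pow]; ring
  have partialSum : ∀ m : ℕ, eLpNorm (low (2 ^ (j + m)) f - low (2 ^ j) f : L2C n)
      (ENNReal.ofReal r) volume ≤
        ENNReal.ofReal (D * q ^ j * N * ∑ i ∈ Finset.range m, q ^ i) := fun m => by
    induction m with
    | zero =>
      simp only [add_zero, sub_self, Finset.range_zero, Finset.sum_empty, mul_zero,
        ENNReal.ofReal_zero, nonpos_iff_eq_zero]
      rw [eLpNorm_congr_ae (Lp.coeFn_zero _ _ _)]
      exact eLpNorm_zero
    | succ m ih =>
      have e : (low (2 ^ (j + (m + 1))) f - low (2 ^ j) f : L2C n) =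
        (low (2 ^ (j + m + 1)) f - low (2 ^ (j + m)) f) + (low (2 ^ (j + m)) f - low (2 ^ j) f) := by
        rw [sub_add_sub_cancel, add_assoc]
      rw [e, eLpNorm_congr_ae (Lp.coeFn_add _ _)]
      refine (eLpNorm_add_le (Lp.aestronglyMeasurable _) (Lp.aestronglyMeasurable _) hrE).trans ?_
      refine (add_le_add (step (j + m)) ih).trans ?_
      rw [← ENNReal.ofReal_add (by positivity) (by positivity), Finset.sum_range_succ]
      refine ENNReal.ofReal_le_ofReal (le_of_eq ?_)
      rw [pow_add]; ring
  have bound : ∀ m : ℕ, eLpNorm (low (2 ^ (j + m)) f - low (2 ^ j) f : L2C n)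
      (ENNReal.ofReal r) volume ≤ ENNReal.ofReal (D / (1 - q) * q ^ j * N) := fun m => by
    refine (partialSum m).trans (ENNReal.ofReal_le_ofReal ?_)
    have hsum : ∑ i ∈ Finset.range m, q ^ i ≤ 1 / (1 - q) := by
      rw [one_div, ← tsum_geometric_of_lt_one hq0 hq1]
      exact (summable_geometric_of_lt_one hq0 hq1).sum_le_tsum _ (fun i _ => by positivity)
    calc _ ≤ D * q ^ j * N * (1 / (1 - q)) := by gcongr
      _ = _ := by ring
  -- The blocks converge only in L² a priori; an almost everywhere convergent subsequence and
  -- Fatou's lemma carry the uniform L^r bound to the limit.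
  have hlim : Tendsto (fun m : ℕ => (low (2 ^ (j + m)) f - low (2 ^ j) f : L2C n)) atTop
      (𝓝 (f - low (2 ^ j) f)) := by
    refine Tendsto.sub_const ?_ _
    rw [tendsto_iff_norm_sub_tendsto_zero]
    refine squeeze_zero (g := fun m => ‖jet u‖ / 2 ^ (j + m)) (fun _ => norm_nonneg _)
      (fun m => by rw [norm_sub_rev]; exact norm_sub_low_le hu (by positivity)) ?_
    refine Tendsto.div_atTop tendsto_const_nhds ?_
    exact (tendsto_pow_atTop_atTop_of_one_lt one_lt_two).comp
      (tendsto_atTop_mono (fun m => Nat.le_add_left m j) tendsto_id)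
  obtain ⟨ns, -, hns⟩ := (tendstoInMeasure_of_tendsto_Lp hlim).exists_seq_tendsto_ae
  refine (Lp.eLpNorm_lim_le_liminf_eLpNorm (fun m => Lp.aestronglyMeasurable _) _ hns).trans ?_
  refine liminf_le_of_le (by isBoundedDefault) fun b hb => ?_
  obtain ⟨m, hm⟩ := hb.exists
  exact hm.trans (bound _)

/-- The subcritical Sobolev embedding `H¹ ⊂ L^r`. -/
theorem exists_eLpNorm_toL2_le {r : ℝ} (hr : 2 < r) (hs : n * (1 / 2 - 1 / r) < 1) :
    ∃ C : ℝ, 0 ≤ C ∧ ∀ u : E n → ℝ, MemH1 u →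
      eLpNorm (toL2 u) (ENNReal.ofReal r) volume ≤ ENNReal.ofReal (C * ‖jet u‖) := by
  obtain ⟨C, q, hC, hq0, -, h⟩ := exists_eLpNorm_sub_low_le hr hs
  have hrE : (1 : ENNReal) ≤ ENNReal.ofReal r := by
    rw [← ENNReal.ofReal_one]; exact ENNReal.ofReal_le_ofReal (by linarith)
  have h1r : 0 ≤ 1 - 2 / r := by
    rw [sub_nonneg, div_le_one (by linarith)]; exact hr.le
  set S := Real.sqrt (volume.real (Metric.ball (0 : E n) 1))
  refine ⟨C + S ^ (1 - 2 / r), by positivity, fun u hu => ?_⟩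
  have h1 := h u hu 0
  rw [pow_zero, pow_zero, mul_one] at h1
  have e : toL2 u = (toL2 u - low 1 (toL2 u)) + low 1 (toL2 u) := by rw [sub_add_cancel]
  have h2 : eLpNorm (low 1 (toL2 u)) (ENNReal.ofReal r) volume ≤
      ENNReal.ofReal (S ^ (1 - 2 / r) * ‖jet u‖) := by
    have hb : ∀ᵐ x, ‖(low 1 (toL2 u)) x‖ ≤ S * ‖toL2 u‖ := by
      filter_upwards [low_ae_eq_lowFun 1 (toL2 u)] with x hx
      rw [hx]; exact norm_lowFun_le _ _ _
    refine (eLpNorm_le_of_ae_norm_le hr hb (by positivity)).trans (ENNReal.ofReal_le_ofReal ?_)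
    have h3 := norm_low_le 1 (toL2 u)
    have h4 := norm_le_norm_jet hu
    calc (S * ‖toL2 u‖) ^ (1 - 2 / r) * ‖low 1 (toL2 u)‖ ^ (2 / r)
        ≤ (S * ‖jet u‖) ^ (1 - 2 / r) * ‖jet u‖ ^ (2 / r) := by
          have : 0 ≤ 2 / r := by positivity
          gcongr
          exact h3.trans h4
      _ = _ := by
          rw [Real.mul_rpow (by positivity) (by positivity), mul_assoc,
            ← Real.rpow_add_of_nonneg (norm_nonneg _) h1r (by positivity), sub_add_cancel,
            Real.rpow_one]
  rw [e, eLpNorm_congr_ae (Lp.coeFn_add _ _)]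
  refine (eLpNorm_add_le (Lp.aestronglyMeasurable _) (Lp.aestronglyMeasurable _) hrE).trans ?_
  refine (add_le_add h1 h2).trans ?_
  rw [← ENNReal.ofReal_add (by positivity) (by positivity), add_mul]

/-- Vanishing: a bounded sequence in `H¹` whose low frequency parts tend to zero uniformly tends
to zero in `L^r`. -/
theorem tendsto_eLpNorm_zero_of_vanishing {r : ℝ} (hr : 2 < r) (hs : n * (1 / 2 - 1 / r) < 1)
    {u : ℕ → E n → ℝ} (hu : ∀ k, MemH1 (u k)) {M : ℝ} (hM : ∀ k, ‖jet (u k)‖ ≤ M)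
    (hv : ∀ j : ℕ, ∀ ε > 0, ∀ᶠ k in atTop, ∀ y, ‖lowFun (2 ^ j) (toL2 (u k)) y‖ ≤ ε) :
    Tendsto (fun k => eLpNorm (toL2 (u k)) (ENNReal.ofReal r) volume) atTop (𝓝 0) := by
  obtain ⟨C, q, hC, hq0, hq1, h⟩ := exists_eLpNorm_sub_low_le hr hs
  have hrE : (1 : ENNReal) ≤ ENNReal.ofReal r := by
    rw [← ENNReal.ofReal_one]; exact ENNReal.ofReal_le_ofReal (by linarith)
  have h1r : 0 < 1 - 2 / r := by
    rw [sub_pos, div_lt_one (by linarith)]; exact hr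
  have hM0 : 0 ≤ M := (norm_nonneg _).trans (hM 0)
  have main : ∀ j : ℕ, ∀ ε > 0, ∀ᶠ k in atTop, eLpNorm (toL2 (u k)) (ENNReal.ofReal r) volume ≤
      ENNReal.ofReal (C * q ^ j * M + ε ^ (1 - 2 / r) * M ^ (2 / r)) := fun j ε hε => by
    filter_upwards [hv j ε hε] with k hk
    have e : toL2 (u k) = (toL2 (u k) - low (2 ^ j) (toL2 (u k))) + low (2 ^ j) (toL2 (u k)) := by
      rw [sub_add_cancel]
    have hb : ∀ᵐ x, ‖(low (2 ^ j) (toL2 (u k))) x‖ ≤ ε := by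
      filter_upwards [low_ae_eq_lowFun (2 ^ j) (toL2 (u k))] with x hx
      rw [hx]; exact hk x
    rw [e, eLpNorm_congr_ae (Lp.coeFn_add _ _)]
    refine (eLpNorm_add_le (Lp.aestronglyMeasurable _) (Lp.aestronglyMeasurable _) hrE).trans ?_
    refine (add_le_add (h _ (hu k) j) (eLpNorm_le_of_ae_norm_le hr hb hε.le)).trans ?_
    rw [← ENNReal.ofReal_add (by positivity) (by positivity)]
    refine ENNReal.ofReal_le_ofReal ?_
    have h3 := ((norm_low_le (2 ^ j) (toL2 (u k))).trans (norm_le_norm_jet (hu k))).trans (hM k)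
    have : 0 ≤ 2 / r := by positivity
    have := hM k
    gcongr
  rw [ENNReal.tendsto_nhds_zero]
  intro ε hε
  -- Taking ε = 1/(j+1) ties both errors to the cutoff index j, which is fixed before k is sent to
  -- infinity.
  have hcont : Tendsto (fun j : ℕ => ENNReal.ofReal (C * q ^ j * M +
      (1 / ((j : ℝ) + 1)) ^ (1 - 2 / r) * M ^ (2 / r))) atTop (𝓝 0) := by
    rw [← ENNReal.ofReal_zero]
    refine ENNReal.tendsto_ofReal ?_
    have t1 := ((tendsto_pow_atTop_nhds_zero_of_lt_one hq0 hq1).const_mul C).mul_const M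
    have t2 := ((tendsto_one_div_add_atTop_nhds_zero_nat (𝕜 := ℝ)).rpow_const
      (Or.inr h1r.le) (p := 1 - 2 / r)).mul_const (M ^ (2 / r))
    rw [Real.zero_rpow h1r.ne'] at t2
    simpa using t1.add t2
  obtain ⟨j, hj⟩ := (hcont.eventually (Iio_mem_nhds hε)).exists
  filter_upwards [main j (1 / ((j : ℝ) + 1)) (by positivity)] with k hk
  exact hk.trans hj.le

/-! ### Weak convergence -/

/-- Weak convergence of a sequence in a Hilbert space. -/
def WeakTendsto {H : Type*} [NormedAddCommGroup H] [InnerProductSpace ℝ H] (x : ℕ → H) (z : H) :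
    Prop :=
  ∀ h : H, Tendsto (fun k => inner ℝ h (x k)) atTop (𝓝 (inner ℝ h z))

section WeakTendsto

variable {H : Type*} [NormedAddCommGroup H] [InnerProductSpace ℝ H] {x : ℕ → H} {z : H}

theorem WeakTendsto.sub_const (h : WeakTendsto x z) (w : H) :
    WeakTendsto (fun k => x k - w) (z - w) := fun a => by
  simpa only [inner_sub_right] using (h a).sub_const _

theorem WeakTendsto.comp (h : WeakTendsto x z) {k : ℕ → ℕ} (hk : StrictMono k) :
    WeakTendsto (fun j => x (k j)) z := fun a => (h a).comp hk.tendsto_atTop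

theorem WeakTendsto.map_real [CompleteSpace H] (h : WeakTendsto x z) (L : H →L[ℝ] ℝ) :
    Tendsto (fun k => L (x k)) atTop (𝓝 (L z)) := by
  have := h ((InnerProductSpace.toDual ℝ H).symm L)
  simpa only [InnerProductSpace.toDual_symm_apply] using this

/-- Weak convergence is tested against real functionals, but evaluation of a low frequency part is
complex-valued. -/
theorem WeakTendsto.map_complex [CompleteSpace H] (h : WeakTendsto x z) (L : H →L[ℝ] ℂ) :
    Tendsto (fun k => L (x k)) atTop (𝓝 (L z)) := by
  have h1 := (Complex.continuous_ofReal.tendsto _).comp (h.map_real (Complex.reCLM.comp L))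
  have h2 := (Complex.continuous_ofReal.tendsto _).comp (h.map_real (Complex.imCLM.comp L))
  have h3 := h1.add (h2.mul_const Complex.I)
  simpa [Function.comp_def, Complex.re_add_im] using h3

end WeakTendsto

theorem exists_subseq_weakTendsto_jet {u : ℕ → E n → ℝ} (hu : ∀ k, MemH1 (u k)) {M : ℝ}
    (hM : ∀ k, ‖jet (u k)‖ ≤ M) :
    ∃ (φ : E n → ℝ) (k : ℕ → ℕ), MemH1 φ ∧ StrictMono k ∧
      WeakTendsto (fun j => jet (u (k j))) (jet φ) := by
  obtain ⟨z, k, hk, hz⟩ := exists_subseq_tendsto_inner hM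
  obtain ⟨φ, hφ, rfl⟩ := exists_jet_eq_of_tendsto_inner (fun j => hu (k j)) hz
  exact ⟨φ, k, hφ, hk, hz⟩

/-- The first component of a pair as a complex-valued function. -/
def pairFst : Pair n →L[ℝ] L2C n :=
  (Complex.ofRealCLM.compLpL 2 (volume : Measure (E n))).comp
    (WithLp.fstL 2 ℝ (Lp ℝ 2 (volume : Measure (E n))) (Lp (E n) 2 (volume : Measure (E n))))

theorem pairFst_jet {u : E n → ℝ} (hu : MemH1 u) : pairFst (jet u) = toL2 u := by
  rw [jet_eq hu]
  refine Lp.ext ?_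
  refine (ContinuousLinearMap.coeFn_compLpL _ _).trans ?_
  filter_upwards [ae_eq_toL2 hu.memLp, hu.memLp.coeFn_toLp] with x h1 h2
  rw [h1]
  change Complex.ofRealCLM ((hu.memLp.toLp u) x) = _
  rw [h2]
  rfl

theorem norm_pairFst_le (z : Pair n) : ‖pairFst z‖ ≤ ‖z‖ := by
  have h1 : ‖pairFst z‖ ≤ ‖z.fst‖ := by
    refine (Lp.norm_le_norm_of_ae_le ?_)
    filter_upwards [ContinuousLinearMap.coeFn_compLpL (p := 2) Complex.ofRealCLM z.fst] with x hx
    change ‖(Complex.ofRealCLM.compLpL 2 (volume : Measure (E n)) z.fst) x‖ ≤ _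
    rw [hx]
    simp
  refine h1.trans ?_
  rw [← sq_le_sq₀ (norm_nonneg _) (norm_nonneg _), WithLp.prod_norm_sq_eq_of_L2]
  nlinarith [sq_nonneg ‖z.snd‖]

/-- Evaluation of a low frequency part at a point is a bounded linear functional on pairs, so weak
convergence becomes convergence at each point. -/
theorem tendsto_lowFun {u : ℕ → E n → ℝ} (hu : ∀ k, MemH1 (u k)) {φ : E n → ℝ} (hφ : MemH1 φ)
    (h : WeakTendsto (fun k => jet (u k)) (jet φ)) (A : ℝ) (y : E n) :
    Tendsto (fun k => lowFun A (toL2 (u k)) y) atTop (𝓝 (lowFun A (toL2 φ) y)) := by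
  let L : Pair n →L[ℝ] ℂ := ((innerSL ℂ (lowKernel A y)).restrictScalars ℝ).comp
    (((Lp.fourierTransformₗᵢ (E n) ℂ).toLinearIsometry.toContinuousLinearMap.restrictScalars ℝ).comp
      pairFst)
  have hL : ∀ v : E n → ℝ, MemH1 v → L (jet v) = lowFun A (toL2 v) y := fun v hv => by
    simp only [L, ContinuousLinearMap.comp_apply, pairFst_jet hv]
    rfl
  have := h.map_complex L
  rw [hL φ hφ] at this
  exact this.congr fun k => hL _ (hu k)

theorem toL2_translate {u : E n → ℝ} (hu : MemLp u 2 volume) (y : E n) :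
    (toL2 (fun x => u (x + y)) : E n → ℂ) =ᵐ[volume] fun x => toL2 u (x + y) := by
  filter_upwards [ae_eq_toL2 (memLp_translate hu y),
    (measurePreserving_add_right volume y).quasiMeasurePreserving.ae (ae_eq_toL2 hu)] with x h1 h2
  rw [h1, h2]

theorem toL2_sub {u v : E n → ℝ} (hu : MemH1 u) (hv : MemH1 v) :
    toL2 (fun x => u x - v x) = toL2 u - toL2 v := by
  rw [← pairFst_jet hu, ← pairFst_jet hv, ← pairFst_jet (hu.sub hv), jet_sub hu hv, map_sub]

/-- A bounded sequence in `H¹` that does not vanish in `L^r` has translates with a nonzero weak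
limit. -/
theorem exists_translates_weakTendsto {r : ℝ} (hr : 2 < r) (hs : n * (1 / 2 - 1 / r) < 1)
    {u : ℕ → E n → ℝ} (hu : ∀ k, MemH1 (u k)) {M : ℝ} (hM : ∀ k, ‖jet (u k)‖ ≤ M)
    (hv : ¬ Tendsto (fun k => eLpNorm (toL2 (u k)) (ENNReal.ofReal r) volume) atTop (𝓝 0)) :
    ∃ (k : ℕ → ℕ) (y : ℕ → E n) (φ : E n → ℝ), StrictMono k ∧ MemH1 φ ∧ toL2 φ ≠ 0 ∧
      WeakTendsto (fun j => jet fun x => u (k j) (x + y j)) (jet φ) := by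
  have h1 : ¬ ∀ j : ℕ, ∀ ε > 0, ∀ᶠ k in atTop, ∀ y, ‖lowFun (2 ^ j) (toL2 (u k)) y‖ ≤ ε :=
    fun h => hv (tendsto_eLpNorm_zero_of_vanishing hr hs hu hM h)
  push Not at h1
  obtain ⟨j, ε, hε, hf⟩ := h1
  obtain ⟨k, hk, hP⟩ := extraction_of_frequently_atTop hf
  choose y hy using hP
  have hw : ∀ i, MemH1 fun x => u (k i) (x + y i) := fun i => (hu _).translate _
  obtain ⟨φ, l, hφ, hl, hlim⟩ := exists_subseq_weakTendsto_jet (M := M) hw fun i => by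
    rw [norm_jet_translate (hu _)]; exact hM _
  refine ⟨k ∘ l, y ∘ l, φ, hk.comp hl, hφ, fun h0 => ?_, hlim⟩
  have h2 := (tendsto_lowFun (fun i => hw (l i)) hφ hlim (2 ^ j) 0).norm
  -- After translation, the large values of the low frequency parts all sit at the origin, and the
  -- lower bound passes to the weak limit.
  have h3 : ε ≤ ‖lowFun (2 ^ j) (toL2 φ) 0‖ := by
    refine ge_of_tendsto' h2 fun i => ?_
    rw [lowFun_translate (toL2_translate (hu _).memLp _), zero_add]
    exact (hy (l i)).le
  have h4 := norm_lowFun_le (2 ^ j) (toL2 φ) 0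
  rw [h0, norm_zero, mul_zero] at h4
  rw [h0] at h3
  linarith

/-- Local compactness: weak convergence in `H¹` implies convergence almost everywhere along a
subsequence. -/
theorem exists_subseq_tendsto_ae {u : ℕ → E n → ℝ} (hu : ∀ k, MemH1 (u k)) {M : ℝ}
    (hM : ∀ k, ‖jet (u k)‖ ≤ M) {φ : E n → ℝ} (hφ : MemH1 φ)
    (h : WeakTendsto (fun k => jet (u k)) (jet φ)) :
    ∃ k : ℕ → ℕ, StrictMono k ∧ ∀ᵐ x, Tendsto (fun j => u (k j) x) atTop (𝓝 (φ x)) := by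
  let v : ℕ → E n → ℝ := fun k x => u k x - φ x
  have hv : ∀ k, MemH1 (v k) := fun k => (hu k).sub hφ
  set N := M + ‖jet φ‖
  have hN : ∀ k, ‖jet (v k)‖ ≤ N := fun k => by
    rw [jet_sub (hu k) hφ]
    exact (norm_sub_le _ _).trans (add_le_add_left (hM k) _)
  have hN0 : 0 ≤ N := (norm_nonneg _).trans (hN 0)
  have hlow : ∀ A y, Tendsto (fun k => lowFun A (toL2 (v k)) y) atTop (𝓝 0) := fun A y => by
    have := (tendsto_lowFun hu hφ h A y).sub_const (lowFun A (toL2 φ) y)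
    rw [sub_self] at this
    refine this.congr fun k => ?_
    rw [← lowFun_sub, ← toL2_sub (hu k) hφ]
  -- A positive weight at most 1, integrable because its decay exponent exceeds n. It replaces an
  -- exhaustion by balls: bounded pointwise convergent functions converge in the weighted L².
  let W : E n → ℝ := fun x => (1 + ‖x‖) ^ (-((n : ℝ) + 1))
  have hW0 : ∀ x, 0 < W x := fun x => by
    have : 0 < 1 + ‖x‖ := by positivity
    positivity
  have hW1 : ∀ x, W x ≤ 1 := fun x =>
    Real.rpow_le_one_of_one_le_of_nonpos (by linarith [norm_nonneg x])
      (by linarith [(Nat.cast_nonneg n : (0 : ℝ) ≤ n)])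
  have hWi : Integrable W volume := integrable_one_add_norm (by
    rw [finrank_euclideanSpace_fin]; linarith)
  have hWc : AEStronglyMeasurable W volume := hWi.1
  have hlowm : ∀ A k, AEStronglyMeasurable (lowFun A (toL2 (v k))) volume := fun A k =>
    (Lp.aestronglyMeasurable _).congr (low_ae_eq_lowFun A (toL2 (v k)))
  have hlowi : ∀ A, Tendsto (fun k => ∫ x, W x * ‖lowFun A (toL2 (v k)) x‖ ^ 2) atTop (𝓝 0) := by
    intro A
    set S := Real.sqrt (volume.real (Metric.ball (0 : E n) A))
    have := tendsto_integral_of_dominated_convergence (μ := volume) (f := fun _ => (0 : ℝ))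
      (F := fun k x => W x * ‖lowFun A (toL2 (v k)) x‖ ^ 2)
      (fun x => W x * (S * N) ^ 2) (fun k => hWc.mul ((hlowm A k).norm.pow 2))
      (hWi.mul_const _) (fun k => ae_of_all _ fun x => ?_) (ae_of_all _ fun x => ?_)
    · simpa using this
    · rw [norm_mul, norm_pow, norm_norm, Real.norm_eq_abs, abs_of_pos (hW0 x)]
      refine mul_le_mul_of_nonneg_left (pow_le_pow_left₀ (norm_nonneg _) ?_ 2) (hW0 x).le
      refine (norm_lowFun_le A _ x).trans (mul_le_mul_of_nonneg_left ?_ (Real.sqrt_nonneg _))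
      exact (norm_le_norm_jet (hv k)).trans (hN k)
    · simpa using ((hlow A x).norm.pow 2).const_mul (W x)
  have hvi : ∀ k, Integrable (fun x => W x * v k x ^ 2) volume := fun k => by
    have h1 := integrable_norm_sq (hv k).memLp
    refine h1.mono (hWc.mul ((hv k).memLp.1.pow 2)) (ae_of_all _ fun x => ?_)
    rw [norm_mul, Real.norm_eq_abs, abs_of_pos (hW0 x), norm_pow, norm_pow, norm_norm]
    exact mul_le_of_le_one_left (by positivity) (hW1 x)
  -- The low frequencies are controlled by dominated convergence for fixed A, the high ones by N/A
  -- uniformly in k. Hence A is chosen first and k afterwards.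
  have hle : ∀ (A : ℝ) (_ : 0 < A) k, ∫ x, W x * v k x ^ 2 ≤
      2 * (∫ x, W x * ‖lowFun A (toL2 (v k)) x‖ ^ 2) + 2 * (N / A) ^ 2 := fun A hA k => by
    have i1 : Integrable (fun x => W x * ‖lowFun A (toL2 (v k)) x‖ ^ 2) volume := by
      have h1 := integrable_norm_sq ((Lp.memLp (low A (toL2 (v k)))).ae_eq (low_ae_eq_lowFun A _))
      refine h1.mono (hWc.mul ((hlowm A k).norm.pow 2)) (ae_of_all _ fun x => ?_)
      rw [norm_mul, Real.norm_eq_abs, abs_of_pos (hW0 x), norm_pow, norm_norm]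
      exact mul_le_of_le_one_left (by positivity) (hW1 x)
    have i2 := integrable_norm_sq (Lp.memLp (toL2 (v k) - low A (toL2 (v k))))
    have h2 : ∫ x, ‖(toL2 (v k) - low A (toL2 (v k)) : L2C n) x‖ ^ 2 ≤ (N / A) ^ 2 := by
      rw [← Lp_two_norm_sq]
      refine pow_le_pow_left₀ (norm_nonneg _) ((norm_sub_low_le (hv k) hA).trans ?_) 2
      have := hN k
      gcongr
    calc ∫ x, W x * v k x ^ 2 ≤ ∫ x, (2 * (W x * ‖lowFun A (toL2 (v k)) x‖ ^ 2) +
          2 * ‖(toL2 (v k) - low A (toL2 (v k)) : L2C n) x‖ ^ 2) := by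
          refine integral_mono_ae (hvi k) ((i1.const_mul 2).add (i2.const_mul 2)) ?_
          filter_upwards [ae_eq_toL2 (hv k).memLp, Lp.coeFn_sub (toL2 (v k)) (low A (toL2 (v k))),
            low_ae_eq_lowFun A (toL2 (v k))] with x e1 e2 e3
          simp only [Pi.sub_apply] at e2
          rw [e2, e1, e3]
          set a := lowFun A (toL2 (v k)) x
          set b := ((v k x : ℝ) : ℂ) - a
          have e4 : v k x ^ 2 = ‖a + b‖ ^ 2 := by
            simp only [b, add_sub_cancel, Complex.norm_real, Real.norm_eq_abs, sq_abs]
          have e5 : ‖a + b‖ ^ 2 ≤ 2 * ‖a‖ ^ 2 + 2 * ‖b‖ ^ 2 := by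
            have := pow_le_pow_left₀ (norm_nonneg _) (norm_add_le a b) 2
            nlinarith [sq_nonneg (‖a‖ - ‖b‖)]
          have e6 := hW0 x
          have e7 := hW1 x
          rw [e4]
          nlinarith [mul_le_mul_of_nonneg_left e5 e6.le, mul_le_mul_of_nonneg_right e7
            (sq_nonneg ‖b‖)]
      _ = 2 * (∫ x, W x * ‖lowFun A (toL2 (v k)) x‖ ^ 2) +
          2 * ∫ x, ‖(toL2 (v k) - low A (toL2 (v k)) : L2C n) x‖ ^ 2 := by
          rw [integral_add (i1.const_mul 2) (i2.const_mul 2), integral_const_mul,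
            integral_const_mul]
      _ ≤ _ := by linarith
  have hlim : Tendsto (fun k => ∫ x, W x * v k x ^ 2) atTop (𝓝 0) := by
    rw [Metric.tendsto_atTop]
    intro ε hε
    have t1 : Tendsto (fun A : ℝ => 2 * (N / A) ^ 2) atTop (𝓝 0) := by
      have : Tendsto (fun A : ℝ => N / A) atTop (𝓝 0) := tendsto_const_nhds.div_atTop tendsto_id
      simpa using (this.pow 2).const_mul 2
    obtain ⟨A, hA1, hA⟩ := ((t1.eventually (gt_mem_nhds (half_pos hε))).and
      (eventually_gt_atTop 0)).exists
    have t2 := (hlowi A).const_mul 2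
    rw [mul_zero] at t2
    obtain ⟨K, hK⟩ := eventually_atTop.1 (t2.eventually (gt_mem_nhds (half_pos hε)))
    refine ⟨K, fun k hk => ?_⟩
    have h3 : 0 ≤ ∫ x, W x * v k x ^ 2 :=
      integral_nonneg fun x => mul_nonneg (hW0 x).le (sq_nonneg _)
    rw [Real.dist_eq, sub_zero, abs_of_nonneg h3]
    linarith [hle A hA k, hK k hk]
  have hmeas : TendstoInMeasure volume (fun k x => W x * v k x ^ 2) atTop fun _ => (0 : ℝ) := by
    refine tendstoInMeasure_of_tendsto_eLpNorm one_ne_zero (fun k => (hvi k).1)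
      aestronglyMeasurable_const ?_
    have e : ∀ k, eLpNorm ((fun x => W x * v k x ^ 2) - fun _ => (0 : ℝ)) 1 volume =
        ENNReal.ofReal (∫ x, W x * v k x ^ 2) := fun k => by
      rw [eLpNorm_one_eq_lintegral_enorm, ofReal_integral_eq_lintegral_ofReal (hvi k)
        (ae_of_all _ fun x => mul_nonneg (hW0 x).le (sq_nonneg _))]
      refine lintegral_congr fun x => ?_
      simp only [Pi.sub_apply, sub_zero]
      rw [Real.enorm_eq_ofReal (mul_nonneg (hW0 x).le (sq_nonneg _))]
    simp only [e]
    simpa using ENNReal.tendsto_ofReal hlim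
  obtain ⟨k, hk, hae⟩ := hmeas.exists_seq_tendsto_ae
  refine ⟨k, hk, ?_⟩
  filter_upwards [hae] with x hx
  have h1 : Tendsto (fun j => v (k j) x ^ 2) atTop (𝓝 0) := by
    have := hx.const_mul (W x)⁻¹
    simpa [(hW0 x).ne'] using this
  have h2 : Tendsto (fun j => v (k j) x) atTop (𝓝 0) := by
    have := h1.sqrt
    rw [Real.sqrt_zero] at this
    simp only [Real.sqrt_sq_eq_abs] at this
    exact (tendsto_zero_iff_abs_tendsto_zero _).2 this
  simpa [v] using h2.add_const (φ x)

/-! ### The quadratic form -/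

theorem fourier_fourierMul (m : E n → ℂ) (hm : MemLp m ⊤ volume) (f : L2C n) :
    ((𝓕 (fourierMul m hm f) : L2C n) : E n → ℂ) =ᵐ[volume] fun ξ => m ξ * (𝓕 f : L2C n) ξ := by
  rw [fourierMul, FourierTransform.fourier_fourierInv_eq]
  exact MemLp.coeFn_toLp _

theorem fourier_injective_ae {f g : L2C n}
    (h : ((𝓕 f : L2C n) : E n → ℂ) =ᵐ[volume] (𝓕 g : L2C n)) : f = g := by
  have h1 : (𝓕 f : L2C n) = 𝓕 g := Lp.ext h
  exact (Lp.fourierTransformₗᵢ (E n) ℂ).injective h1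

theorem fourierMul_add (m : E n → ℂ) (hm : MemLp m ⊤ volume) (f g : L2C n) :
    fourierMul m hm (f + g) = fourierMul m hm f + fourierMul m hm g := by
  refine fourier_injective_ae ?_
  have h1 : ((𝓕 (f + g) : L2C n) : E n → ℂ) =ᵐ[volume] (𝓕 f : L2C n) + (𝓕 g : L2C n) := by
    rw [FourierTransform.fourier_add]; exact Lp.coeFn_add _ _
  have h2 : ((𝓕 (fourierMul m hm f + fourierMul m hm g) : L2C n) : E n → ℂ) =ᵐ[volume]
      (𝓕 (fourierMul m hm f) : L2C n) + (𝓕 (fourierMul m hm g) : L2C n) := by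
    rw [FourierTransform.fourier_add]; exact Lp.coeFn_add _ _
  filter_upwards [h1, h2, fourier_fourierMul m hm f, fourier_fourierMul m hm g,
    fourier_fourierMul m hm (f + g)] with ξ e1 e2 e3 e4 e5
  rw [e5, e2, e1, Pi.add_apply, Pi.add_apply, e3, e4, mul_add]

theorem fourierMul_smul (m : E n → ℂ) (hm : MemLp m ⊤ volume) (a : ℂ) (f : L2C n) :
    fourierMul m hm (a • f) = a • fourierMul m hm f := by
  refine fourier_injective_ae ?_
  have h1 : ((𝓕 (a • f) : L2C n) : E n → ℂ) =ᵐ[volume] a • (𝓕 f : L2C n) := by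
    rw [FourierTransform.fourier_smul]; exact Lp.coeFn_smul _ _
  have h2 : ((𝓕 (a • fourierMul m hm f) : L2C n) : E n → ℂ) =ᵐ[volume]
      a • (𝓕 (fourierMul m hm f) : L2C n) := by
    rw [FourierTransform.fourier_smul]; exact Lp.coeFn_smul _ _
  filter_upwards [h1, h2, fourier_fourierMul m hm f, fourier_fourierMul m hm (a • f)]
    with ξ e1 e2 e3 e5
  rw [e5, e2, e1, Pi.smul_apply, Pi.smul_apply, e3, smul_eq_mul, smul_eq_mul, mul_left_comm]

theorem norm_fourierMul_le {m : E n → ℂ} (hm : MemLp m ⊤ volume) {C : ℝ} (hC : ∀ ξ, ‖m ξ‖ ≤ C)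
    (f : L2C n) : ‖fourierMul m hm f‖ ≤ C * ‖f‖ := by
  rw [← Lp.norm_fourier_eq, ← Lp.norm_fourier_eq f]
  refine Lp.norm_le_mul_norm_of_ae_le_mul ?_
  filter_upwards [fourier_fourierMul m hm f] with ξ h
  rw [h, norm_mul]
  exact mul_le_mul_of_nonneg_right (hC ξ) (norm_nonneg _)

theorem norm_symbolHalf_le (c ξ : E n) : ‖symbolHalf c ξ‖ ≤ ‖c‖ := by
  rw [symbolHalf, norm_mul, Complex.norm_I, one_mul, Complex.norm_real]
  exact abs_inner_div_norm_le c ξ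

theorem real_smul_eq_coe_smul (a : ℝ) (f : L2C n) : a • f = (a : ℂ) • f := by
  refine Lp.ext ?_
  filter_upwards [Lp.coeFn_smul a f, Lp.coeFn_smul (a : ℂ) f] with x h1 h2
  rw [h1, h2]
  simp

theorem norm_fourierMul_symbolHalf_le (c : E n) (z : Pair n) :
    ‖fourierMul (symbolHalf c) (memLp_symbolHalf c) (pairFst z)‖ ≤ ‖c‖ * ‖z‖ :=
  (norm_fourierMul_le _ (norm_symbolHalf_le c) _).trans
    (mul_le_mul_of_nonneg_left (norm_pairFst_le z) (norm_nonneg _))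

/-- The operator `L_c^{1/2}` on pairs. -/
def halfCLM (c : E n) : Pair n →L[ℝ] L2C n :=
  LinearMap.mkContinuous
    { toFun := fun z => fourierMul (symbolHalf c) (memLp_symbolHalf c) (pairFst z)
      map_add' := fun z w => by rw [map_add, fourierMul_add]
      map_smul' := fun a z => by
        rw [map_smul, RingHom.id_apply, real_smul_eq_coe_smul, fourierMul_smul,
          real_smul_eq_coe_smul] }
    ‖c‖ (norm_fourierMul_symbolHalf_le c)

theorem halfCLM_apply (c : E n) (z : Pair n) :
    halfCLM c z = fourierMul (symbolHalf c) (memLp_symbolHalf c) (pairFst z) := rfl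

theorem halfCLM_jet (c : E n) {u : E n → ℝ} (hu : MemH1 u) : halfCLM c (jet u) = LcHalf c u := by
  rw [LcHalf, ← pairFst_jet hu, halfCLM_apply]

theorem norm_halfCLM_le (c : E n) (z : Pair n) : ‖halfCLM c z‖ ≤ ‖c‖ * ‖z‖ :=
  norm_fourierMul_symbolHalf_le c z

/-- The quadratic form with `J(u) = Q(u, ∇u) / 2`. -/
def Q (c : E n) (z : Pair n) : ℝ := ‖z‖ ^ 2 - ‖halfCLM c z‖ ^ 2

/-- The polarization of `Q`. -/
def Qpolar (c : E n) (z : Pair n) : Pair n →L[ℝ] ℝ :=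
  innerSL ℝ z - Complex.reCLM.comp
    (((innerSL ℂ (halfCLM c z)).restrictScalars ℝ).comp (halfCLM c))

theorem Qpolar_apply (c : E n) (z w : Pair n) :
    Qpolar c z w = inner ℝ z w - (inner ℂ (halfCLM c z) (halfCLM c w)).re := rfl

theorem Q_add (c : E n) (z w : Pair n) : Q c (z + w) = Q c z + Q c w + 2 * Qpolar c z w := by
  rw [Q, Q, Q, Qpolar_apply, map_add, norm_add_sq_real, norm_add_sq (𝕜 := ℂ)]
  simp only [RCLike.re_eq_complex_re]
  ring

theorem Q_smul (c : E n) (a : ℝ) (z : Pair n) : Q c (a • z) = a ^ 2 * Q c z := by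
  rw [Q, Q, map_smul, norm_smul, norm_smul, mul_pow, mul_pow, Real.norm_eq_abs, sq_abs]
  ring

/-- Coercivity: the symbol of `L_c^{1/2}` is bounded by |c|, so the negative term takes away at most
the fraction |c|² of the squared norm. -/
theorem le_Q (c : E n) (z : Pair n) : (1 - ‖c‖ ^ 2) * ‖z‖ ^ 2 ≤ Q c z := by
  have := pow_le_pow_left₀ (norm_nonneg _) (norm_halfCLM_le c z) 2
  rw [mul_pow] at this
  rw [Q]; linarith

theorem Q_nonneg {c : E n} (hc : ‖c‖ < 1) (z : Pair n) : 0 ≤ Q c z := by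
  refine le_trans (mul_nonneg ?_ (sq_nonneg _)) (le_Q c z)
  nlinarith [norm_nonneg c]

theorem J_eq (c : E n) {u : E n → ℝ} (hu : MemH1 u) : J c u = 1 / 2 * Q c (jet u) := by
  have hu' := integrable_norm_sq hu.memLp
  simp only [Real.norm_eq_abs, sq_abs] at hu'
  have i1 := (integrable_norm_sq hu.memLp_weakGrad).add hu'
  have i2 := integrable_norm_sq (Lp.memLp (LcHalf c u))
  rw [J, Q, halfCLM_jet c hu, norm_jet_sq hu, Lp_two_norm_sq]
  congr 1
  exact integral_sub i1 i2

/-- A translation multiplies the Fourier transform by a factor of modulus one, so it commutes with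
the multiplier and preserves the norm of its output. -/
theorem J_translate (c : E n) {u : E n → ℝ} (hu : MemH1 u) (y : E n) :
    J c (fun x => u (x + y)) = J c u := by
  rw [J_eq c hu, J_eq c (hu.translate y), Q, Q, norm_jet_translate hu, halfCLM_jet c hu,
    halfCLM_jet c (hu.translate y)]
  congr 2
  rw [← Lp.norm_fourier_eq, ← Lp.norm_fourier_eq (LcHalf c u), Lp_two_norm_sq, Lp_two_norm_sq]
  refine integral_congr_ae ?_
  filter_upwards [fourier_fourierMul (symbolHalf c) (memLp_symbolHalf c) (toL2 u),
    fourier_fourierMul (symbolHalf c) (memLp_symbolHalf c) (toL2 fun x => u (x + y)),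
    fourier_translate_ae_eq (toL2_translate hu.memLp y)] with ξ h1 h2 h3
  rw [LcHalf, LcHalf, h1, h2, h3]
  simp only [norm_mul, Circle.norm_coe, one_mul]

theorem J_const_mul (c : E n) {u : E n → ℝ} (hu : MemH1 u) (a : ℝ) :
    J c (fun x => a * u x) = a ^ 2 * J c u := by
  rw [J_eq c hu, J_eq c (hu.const_mul a), jet_const_mul hu, Q_smul]; ring

/-- Writing x_k = z + (x_k − z), the only cross term is a fixed bounded functional applied to a
weakly null sequence. This is the quadratic analogue of the Brezis–Lieb splitting. -/
theorem tendsto_Q_sub {c : E n} {x : ℕ → Pair n} {z : Pair n} (h : WeakTendsto x z) :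
    Tendsto (fun k => Q c (x k) - Q c (x k - z)) atTop (𝓝 (Q c z)) := by
  have h1 := ((h.sub_const z).map_real (Qpolar c z)).const_mul 2
  rw [sub_self, map_zero, mul_zero] at h1
  have h2 := h1.const_add (Q c z)
  rw [add_zero] at h2
  refine h2.congr fun k => ?_
  have := Q_add c z (x k - z)
  rw [add_sub_cancel] at this
  rw [this]; ring

/-- The first variation of `J` in terms of `L_c`. -/
theorem Qpolar_jet (c : E n) {u v : E n → ℝ} (hu : MemH1 u) (hv : MemH1 v) :
    Qpolar c (jet u) (jet v) =
      ∫ x, ((u x + Lc c u x) * v x + inner ℝ (weakGrad u x) (weakGrad v x)) := by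
  set f : L2C n := fourierMul (symbol c) (memLp_symbol c) (toL2 u)
  have hf : MemLp (Lc c u) 2 volume := (Lp.memLp f).re
  have h1 : inner ℂ (LcHalf c u) (LcHalf c v) = - inner ℂ f (toL2 v) := by
    rw [← Lp.inner_fourier_eq (LcHalf c u), ← Lp.inner_fourier_eq f, L2.inner_def, L2.inner_def,
      ← integral_neg]
    refine integral_congr_ae ?_
    filter_upwards [fourier_fourierMul (symbolHalf c) (memLp_symbolHalf c) (toL2 u),
      fourier_fourierMul (symbolHalf c) (memLp_symbolHalf c) (toL2 v),
      fourier_fourierMul (symbol c) (memLp_symbol c) (toL2 u)] with ξ e1 e2 e3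
    rw [LcHalf, LcHalf, e1, e2, e3]
    -- `L_c^{1/2}` has a purely imaginary symbol, so it is skew-adjoint and its squared modulus is
    -- minus the symbol of `L_c`. Hence the sign change when the half operators are merged.
    have e4 : starRingEnd ℂ (symbolHalf c ξ) * symbolHalf c ξ =
        - starRingEnd ℂ (symbol c ξ) := by
      rw [symbolHalf, symbol, map_mul, Complex.conj_I, Complex.conj_ofReal, Complex.conj_ofReal]
      push_cast
      rw [← div_pow]
      linear_combination (-(((inner ℝ c ξ : ℝ) : ℂ) / (‖ξ‖ : ℂ)) ^ 2) * Complex.I_sq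
    simp only [RCLike.inner_apply, map_mul]
    linear_combination ((𝓕 (toL2 v) : L2C n) ξ * starRingEnd ℂ ((𝓕 (toL2 u) : L2C n) ξ)) * e4
  have h2 : (inner ℂ f (toL2 v)).re = ∫ x, Lc c u x * v x := by
    rw [L2.inner_def]
    have := integral_re (L2.integrable_inner (𝕜 := ℂ) f (toL2 v))
    simp only [RCLike.re_eq_complex_re] at this
    rw [← this]
    refine integral_congr_ae ?_
    filter_upwards [ae_eq_toL2 hv.memLp] with x hx
    rw [hx, RCLike.inner_apply]
    simp [Lc, f, mul_comm]
  rw [Qpolar_apply, halfCLM_jet c hu, halfCLM_jet c hv, h1, Complex.neg_re, h2, inner_jet hu hv,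
    sub_neg_eq_add]
  have i1 := (integrable_mul_of_memLp_two hu.memLp hv.memLp).add
    (integrable_inner_of_memLp_two hu.memLp_weakGrad hv.memLp_weakGrad)
  refine (integral_add i1 (integrable_mul_of_memLp_two hf hv.memLp)).symm.trans ?_
  refine integral_congr_ae (ae_of_all _ fun x => ?_)
  simp only [Pi.add_apply]
  ring

/-! ### The Brezis–Lieb lemma -/

/-- Two regimes. If |a| is at most a multiple of |b|, every term is bounded by |b|^r. Otherwise one
divides by |a|^r and uses continuity of |1+s|^r − 1 − |s|^r at s = 0, where it vanishes. -/
theorem exists_abs_add_rpow_sub_le {r : ℝ} (hr : 0 < r) {ε : ℝ} (hε : 0 < ε) :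
    ∃ C : ℝ, 0 ≤ C ∧ ∀ a b : ℝ,
      |(|a + b| ^ r - |a| ^ r - |b| ^ r)| ≤ ε * |a| ^ r + C * |b| ^ r := by
  have hcont : Continuous fun s : ℝ => |1 + s| ^ r - 1 - |s| ^ r :=
    (((continuous_const.add continuous_id).abs.rpow_const fun _ => Or.inr hr.le).sub
      continuous_const).sub (continuous_abs.rpow_const fun _ => Or.inr hr.le)
  have h0 : Tendsto (fun s : ℝ => |1 + s| ^ r - 1 - |s| ^ r) (𝓝 0) (𝓝 0) := by
    have := hcont.tendsto 0
    simpa [Real.zero_rpow hr.ne'] using this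
  obtain ⟨δ, hδ, h⟩ := Metric.tendsto_nhds_nhds.1 h0 ε hε
  set D := 2 / δ
  have hD : 0 < D := by positivity
  refine ⟨(D + 1) ^ r + D ^ r + 1, by positivity, fun a b => ?_⟩
  have ha0 : 0 ≤ |a| ^ r := by positivity
  have hb0 : 0 ≤ |b| ^ r := by positivity
  by_cases hab : |a| ≤ D * |b|
  · have h1 : |a + b| ^ r ≤ (D + 1) ^ r * |b| ^ r := by
      rw [← Real.mul_rpow (by positivity) (abs_nonneg _)]
      refine Real.rpow_le_rpow (abs_nonneg _) ?_ hr.le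
      linarith [abs_add_le a b]
    have h2 : |a| ^ r ≤ D ^ r * |b| ^ r := by
      rw [← Real.mul_rpow hD.le (abs_nonneg _)]
      exact Real.rpow_le_rpow (abs_nonneg _) hab hr.le
    have h3 : 0 ≤ |a + b| ^ r := by positivity
    have h4 : 0 ≤ ε * |a| ^ r := by positivity
    rw [abs_le]
    constructor <;> nlinarith
  · push Not at hab
    have ha : 0 < |a| := lt_of_le_of_lt (by positivity) hab
    have ha' : a ≠ 0 := abs_pos.1 ha
    have hs : dist (b / a) 0 < δ := by
      rw [dist_zero_right, Real.norm_eq_abs, abs_div, div_lt_iff₀ ha]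
      have h1 : δ * (D * |b|) < δ * |a| := mul_lt_mul_of_pos_left hab hδ
      have h2 : δ * (D * |b|) = 2 * |b| := by simp only [D]; field_simp
      linarith [abs_nonneg b]
    have h1 := h hs
    rw [dist_zero_right, Real.norm_eq_abs] at h1
    have h2 : |a + b| ^ r - |a| ^ r - |b| ^ r =
        |a| ^ r * (|1 + b / a| ^ r - 1 - |b / a| ^ r) := by
      have e1 : a + b = a * (1 + b / a) := by field_simp
      have e2 : b = a * (b / a) := by field_simp
      have e3 : |a + b| ^ r = |a| ^ r * |1 + b / a| ^ r := by
        rw [e1, abs_mul, Real.mul_rpow (abs_nonneg _) (abs_nonneg _)]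
      have e4 : |b| ^ r = |a| ^ r * |b / a| ^ r := by
        conv_lhs => rw [e2]
        rw [abs_mul, Real.mul_rpow (abs_nonneg _) (abs_nonneg _)]
      rw [e3, e4]; ring
    rw [h2, abs_mul, abs_of_nonneg ha0]
    have h3 : 0 ≤ ((D + 1) ^ r + D ^ r + 1) * |b| ^ r := by positivity
    nlinarith

/-- The Brezis–Lieb lemma. -/
theorem tendsto_integral_rpow_sub {α : Type*} [MeasurableSpace α] {μ : Measure α} {r : ℝ}
    (hr : 0 < r) {f : ℕ → α → ℝ} {g : α → ℝ}
    (hfi : ∀ k, Integrable (fun x => |f k x| ^ r) μ)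
    (hgi : Integrable (fun x => |g x| ^ r) μ)
    (hvi : ∀ k, Integrable (fun x => |f k x - g x| ^ r) μ) {M : ℝ}
    (hM : ∀ k, ∫ x, |f k x - g x| ^ r ∂μ ≤ M)
    (hlim : ∀ᵐ x ∂μ, Tendsto (fun k => f k x) atTop (𝓝 (g x))) :
    Tendsto (fun k => ∫ x, |f k x| ^ r ∂μ - ∫ x, |f k x - g x| ^ r ∂μ) atTop
      (𝓝 (∫ x, |g x| ^ r ∂μ)) := by
  have hM0 : 0 ≤ M := (integral_nonneg fun x => by positivity).trans (hM 0)
  rw [Metric.tendsto_atTop]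
  intro ε hε
  obtain ⟨C, hC, hineq⟩ := exists_abs_add_rpow_sub_le hr
    (show 0 < ε / (2 * (M + 1)) by positivity)
  set η := ε / (2 * (M + 1))
  have hη : 0 < η := by positivity
  have hηM : η * M ≤ ε / 2 := by
    simp only [η]
    rw [div_mul_eq_mul_div, div_le_div_iff₀ (by positivity) two_pos]
    nlinarith
  let D : ℕ → α → ℝ := fun k x => |f k x| ^ r - |f k x - g x| ^ r - |g x| ^ r
  have hD : ∀ k, Integrable (D k) μ := fun k => ((hfi k).sub (hvi k)).sub hgi
  -- Subtracting the small multiple of |f_k − g|^r leaves an excess dominated by C|g|^r, so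
  -- dominated convergence applies to it. The subtracted part has integral at most ηM ≤ ε/2.
  let W : ℕ → α → ℝ := fun k x => max (|D k x| - η * |f k x - g x| ^ r) 0
  have hW0 : ∀ k x, 0 ≤ W k x := fun k x => le_max_right _ _
  have hWle : ∀ k x, W k x ≤ C * |g x| ^ r := fun k x => by
    refine max_le ?_ (by positivity)
    have := hineq (f k x - g x) (g x)
    rw [sub_add_cancel] at this
    linarith
  have hWm : ∀ k, AEStronglyMeasurable (W k) μ := fun k =>
    (((hD k).1.norm).sub ((hvi k).1.const_mul η)).sup aestronglyMeasurable_const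
  have hWi : ∀ k, Integrable (W k) μ := fun k =>
    (hgi.const_mul C).mono' (hWm k) (ae_of_all _ fun x => by
      rw [Real.norm_eq_abs, abs_of_nonneg (hW0 k x)]; exact hWle k x)
  have hWlim : Tendsto (fun k => ∫ x, W k x ∂μ) atTop (𝓝 0) := by
    have := tendsto_integral_of_dominated_convergence (μ := μ) (f := fun _ => (0 : ℝ)) (F := W)
      (fun x => C * |g x| ^ r) hWm (hgi.const_mul C)
      (fun k => ae_of_all _ fun x => by
        rw [Real.norm_eq_abs, abs_of_nonneg (hW0 k x)]; exact hWle k x) ?_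
    · simpa using this
    · filter_upwards [hlim] with x hx
      have t1 : Tendsto (fun k => |f k x| ^ r) atTop (𝓝 (|g x| ^ r)) :=
        hx.abs.rpow_const (Or.inr hr.le)
      have t2 : Tendsto (fun k => |f k x - g x| ^ r) atTop (𝓝 0) := by
        have := (hx.sub_const (g x)).abs.rpow_const (p := r) (Or.inr hr.le)
        simpa [Real.zero_rpow hr.ne'] using this
      have t3 : Tendsto (fun k => D k x) atTop (𝓝 0) := by
        simpa using (t1.sub t2).sub_const (|g x| ^ r)
      have t4 := ((t3.abs).sub (t2.const_mul η)).max (tendsto_const_nhds (x := (0 : ℝ)))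
      simpa using t4
  obtain ⟨N, hN⟩ := eventually_atTop.1 (hWlim.eventually (gt_mem_nhds (half_pos hε)))
  refine ⟨N, fun k hk => ?_⟩
  have e1 : ∫ x, |f k x| ^ r ∂μ - ∫ x, |f k x - g x| ^ r ∂μ - ∫ x, |g x| ^ r ∂μ =
      ∫ x, D k x ∂μ := by
    rw [← integral_sub (hfi k) (hvi k)]
    exact (integral_sub ((hfi k).sub (hvi k)) hgi).symm
  rw [Real.dist_eq, e1]
  calc |∫ x, D k x ∂μ| ≤ ∫ x, |D k x| ∂μ := abs_integral_le_integral_abs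
    _ ≤ ∫ x, (W k x + η * |f k x - g x| ^ r) ∂μ := by
        refine integral_mono (hD k).abs ((hWi k).add ((hvi k).const_mul η)) fun x => ?_
        have := le_max_left (|D k x| - η * |f k x - g x| ^ r) 0
        simp only [W]
        linarith
    _ = ∫ x, W k x ∂μ + η * ∫ x, |f k x - g x| ^ r ∂μ := by
        rw [integral_add (hWi k) ((hvi k).const_mul η), integral_const_mul]
    _ < ε := by
        have := mul_le_mul_of_nonneg_left (hM k) hη.le
        linarith [hN k hk]

/-! ### The functional `K` -/

/-- The exponent `r` is Sobolev subcritical in dimension `n`. -/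
def Subcritical (n : ℕ) (p : ℝ) : Prop := 1 < p ∧ n * (1 / 2 - 1 / (p + 1)) < 1

/-- In dimension 2 the inequality holds for every p > 1. For n > 2, clearing denominators turns it
into p(n − 2) < n + 2. -/
theorem subcritical_of_lt (hn : 2 ≤ n) {p : ℝ} (hp : 1 < p)
    (h : 2 < n → p < ((n : ℝ) + 2) / ((n : ℝ) - 2)) : Subcritical n p := by
  refine ⟨hp, ?_⟩
  have hr : 0 < p + 1 := by linarith
  rcases hn.eq_or_lt with rfl | h2
  · have : 0 < 1 / (p + 1) := by positivity
    push_cast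
    linarith
  · have h3 : (2 : ℝ) < n := by exact_mod_cast h2
    have h4 := h h2
    rw [lt_div_iff₀ (by linarith)] at h4
    have e : (n : ℝ) * (1 / 2 - 1 / (p + 1)) = n * (p - 1) / (2 * (p + 1)) := by
      field_simp; ring
    rw [e, div_lt_one (by positivity)]
    linarith

theorem eLpNorm_toL2 {u : E n → ℝ} (hu : MemH1 u) (q : ENNReal) :
    eLpNorm (toL2 u) q volume = eLpNorm u q volume := by
  refine eLpNorm_congr_norm_ae ?_
  filter_upwards [ae_eq_toL2 hu.memLp] with x hx
  rw [hx, Complex.norm_real]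

variable {p : ℝ}

theorem Subcritical.memLp (hp : Subcritical n p) {u : E n → ℝ} (hu : MemH1 u) :
    MemLp u (ENNReal.ofReal (p + 1)) volume := by
  obtain ⟨C, -, hC⟩ := exists_eLpNorm_toL2_le (by linarith [hp.1] : 2 < p + 1) hp.2
  refine ⟨hu.memLp.1, ?_⟩
  rw [← eLpNorm_toL2 hu]
  exact (hC u hu).trans_lt ENNReal.ofReal_lt_top

theorem Subcritical.integrable (hp : Subcritical n p) {u : E n → ℝ} (hu : MemH1 u) :
    Integrable (fun x => |u x| ^ (p + 1)) volume := by
  have hr : 0 < p + 1 := by linarith [hp.1]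
  have := (hp.memLp hu).integrable_norm_rpow (by simpa using hr) ENNReal.ofReal_ne_top
  simpa [ENNReal.toReal_ofReal hr.le] using this

theorem Subcritical.integral_eq (hp : Subcritical n p) {u : E n → ℝ} (hu : MemH1 u) :
    ∫ x, |u x| ^ (p + 1) =
      (eLpNorm (toL2 u) (ENNReal.ofReal (p + 1)) volume).toReal ^ (p + 1) := by
  have hr : 0 < p + 1 := by linarith [hp.1]
  have h0 : 0 ≤ ∫ x, |u x| ^ (p + 1) := integral_nonneg fun x => by positivity
  rw [eLpNorm_toL2 hu, (hp.memLp hu).eLpNorm_eq_integral_rpow_norm (by simpa using hr)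
    ENNReal.ofReal_ne_top, ENNReal.toReal_ofReal hr.le]
  simp only [Real.norm_eq_abs]
  rw [ENNReal.toReal_ofReal (by positivity), ← Real.rpow_mul h0, inv_mul_cancel₀ hr.ne',
    Real.rpow_one]

theorem K_nonneg (hp : Subcritical n p) (u : E n → ℝ) : 0 ≤ K p u := by
  have hr : 0 < p + 1 := by linarith [hp.1]
  exact mul_nonneg (by positivity) (integral_nonneg fun x => by positivity)

theorem exists_K_le (hp : Subcritical n p) :
    ∃ C : ℝ, 0 ≤ C ∧ ∀ u : E n → ℝ, MemH1 u → K p u ≤ C * ‖jet u‖ ^ (p + 1) := by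
  have hr : 0 < p + 1 := by linarith [hp.1]
  obtain ⟨C, hC0, hC⟩ := exists_eLpNorm_toL2_le (by linarith [hp.1] : 2 < p + 1) hp.2
  refine ⟨1 / (p + 1) * C ^ (p + 1), by positivity, fun u hu => ?_⟩
  rw [K, hp.integral_eq hu, mul_assoc, ← Real.mul_rpow hC0 (norm_nonneg _)]
  refine mul_le_mul_of_nonneg_left (Real.rpow_le_rpow ENNReal.toReal_nonneg ?_ hr.le)
    (by positivity)
  exact ENNReal.toReal_le_of_le_ofReal (by positivity) (hC u hu)

theorem tendsto_K_zero (hp : Subcritical n p) {u : ℕ → E n → ℝ} (hu : ∀ k, MemH1 (u k))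
    (h : Tendsto (fun k => eLpNorm (toL2 (u k)) (ENNReal.ofReal (p + 1)) volume) atTop (𝓝 0)) :
    Tendsto (fun k => K p (u k)) atTop (𝓝 0) := by
  have hr : 0 < p + 1 := by linarith [hp.1]
  have h1 := ((ENNReal.tendsto_toReal ENNReal.zero_ne_top).comp h).rpow_const (p := p + 1)
    (Or.inr hr.le)
  have h2 := h1.const_mul (1 / (p + 1))
  simp only [ENNReal.toReal_zero, Real.zero_rpow hr.ne', mul_zero] at h2
  refine h2.congr fun k => ?_
  rw [K, hp.integral_eq (hu k)]
  rfl

theorem K_translate (u : E n → ℝ) (y : E n) : K p (fun x => u (x + y)) = K p u := by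
  rw [K, K, integral_add_right_eq_self (fun x => |u x| ^ (p + 1)) y]

theorem K_const_mul (u : E n → ℝ) {a : ℝ} (ha : 0 ≤ a) :
    K p (fun x => a * u x) = a ^ (p + 1) * K p u := by
  rw [K, K, mul_left_comm, ← integral_const_mul (a ^ (p + 1))]
  refine congrArg (1 / (p + 1) * ·) (integral_congr_ae (ae_of_all _ fun x => ?_))
  dsimp only
  rw [abs_mul, abs_of_nonneg ha, Real.mul_rpow ha (abs_nonneg _)]

theorem ae_eq_zero_of_K_eq_zero (hp : Subcritical n p) {u : E n → ℝ} (hu : MemH1 u)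
    (h : K p u = 0) : u =ᵐ[volume] 0 := by
  have hr : 0 < p + 1 := by linarith [hp.1]
  have h1 : ∫ x, |u x| ^ (p + 1) = 0 := by
    rw [K] at h
    exact (mul_eq_zero.1 h).resolve_left (by positivity)
  rw [integral_eq_zero_iff_of_nonneg (fun x => by positivity) (hp.integrable hu)] at h1
  filter_upwards [h1] with x hx
  simpa using (Real.rpow_eq_zero (abs_nonneg _) hr.ne').1 hx

/-- The uniform bound required by the Brezis–Lieb lemma comes from the Sobolev embedding applied to
the remainders. -/
theorem tendsto_K_sub (hp : Subcritical n p) {u : ℕ → E n → ℝ} (hu : ∀ k, MemH1 (u k)) {M : ℝ}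
    (hM : ∀ k, ‖jet (u k)‖ ≤ M) {φ : E n → ℝ} (hφ : MemH1 φ)
    (hlim : ∀ᵐ x, Tendsto (fun k => u k x) atTop (𝓝 (φ x))) :
    Tendsto (fun k => K p (u k) - K p (fun x => u k x - φ x)) atTop (𝓝 (K p φ)) := by
  have hr : 0 < p + 1 := by linarith [hp.1]
  obtain ⟨C, hC0, hC⟩ := exists_K_le (n := n) hp
  have hb : ∀ k, ∫ x, |u k x - φ x| ^ (p + 1) ≤
      (p + 1) * (C * (M + ‖jet φ‖) ^ (p + 1)) := fun k => by
    have h1 := hC _ ((hu k).sub hφ)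
    have h2 : ‖jet fun x => u k x - φ x‖ ≤ M + ‖jet φ‖ := by
      rw [jet_sub (hu k) hφ]
      exact (norm_sub_le _ _).trans (add_le_add_left (hM k) _)
    have h3 : K p (fun x => u k x - φ x) ≤ C * (M + ‖jet φ‖) ^ (p + 1) :=
      h1.trans (mul_le_mul_of_nonneg_left (Real.rpow_le_rpow (norm_nonneg _) h2 hr.le) hC0)
    rw [K, div_mul_eq_mul_div, one_mul, div_le_iff₀ hr] at h3
    linarith
  have := (tendsto_integral_rpow_sub hr (fun k => hp.integrable (hu k))
    (hp.integrable hφ) (fun k => hp.integrable ((hu k).sub hφ)) hb hlim).const_mul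
    (1 / (p + 1))
  refine this.congr fun k => ?_
  rw [K, K, mul_sub]

/-! ### Scaling of the infimum -/

theorem J_nonneg {c : E n} (hc : ‖c‖ < 1) {u : E n → ℝ} (hu : MemH1 u) : 0 ≤ J c u := by
  rw [J_eq c hu]
  have := Q_nonneg hc (jet u)
  positivity

theorem norm_jet_sq_le {c : E n} (hc : ‖c‖ < 1) {u : E n → ℝ} (hu : MemH1 u) :
    ‖jet u‖ ^ 2 ≤ 2 / (1 - ‖c‖ ^ 2) * J c u := by
  have h1 : 0 < 1 - ‖c‖ ^ 2 := by nlinarith [norm_nonneg c]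
  have h2 := le_Q c (jet u)
  rw [J_eq c hu, div_mul_eq_mul_div, le_div_iff₀ h1]
  linarith

theorem bddBelow_J {c : E n} (hc : ‖c‖ < 1) (lam : ℝ) :
    BddBelow {r : ℝ | ∃ u : E n → ℝ, MemH1 u ∧ K p u = lam ∧ J c u = r} :=
  ⟨0, by rintro r ⟨u, hu, -, rfl⟩; exact J_nonneg hc hu⟩

theorem mInf_le {c : E n} (hc : ‖c‖ < 1) {u : E n → ℝ} (hu : MemH1 u) :
    mInf c p (K p u) ≤ J c u :=
  csInf_le (bddBelow_J hc _) ⟨u, hu, rfl, rfl⟩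

/-- `J` has degree 2 and `K` degree p + 1, so multiplying u by (lam / K(u))^(1/(p+1)) hits the
constraint. -/
theorem exists_scaled (hp : Subcritical n p) (c : E n) {u : E n → ℝ} (hu : MemH1 u)
    (h0 : 0 < K p u) {lam : ℝ} (hlam : 0 < lam) :
    ∃ v : E n → ℝ, MemH1 v ∧ K p v = lam ∧
      J c v = (lam / K p u) ^ (2 / (p + 1)) * J c u := by
  have hr : 0 < p + 1 := by linarith [hp.1]
  have hq : 0 ≤ lam / K p u := by positivity
  refine ⟨_, hu.const_mul ((lam / K p u) ^ (1 / (p + 1))), ?_, ?_⟩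
  · rw [K_const_mul _ (by positivity), ← Real.rpow_mul hq, one_div_mul_cancel hr.ne',
      Real.rpow_one, div_mul_cancel₀ _ h0.ne']
  · rw [J_const_mul c hu, ← Real.rpow_natCast, ← Real.rpow_mul hq]
    congr 2
    push_cast; ring

theorem feasible_nonempty (hp : Subcritical n p) (c : E n) {lam : ℝ} (hlam : 0 < lam) :
    {r : ℝ | ∃ u : E n → ℝ, MemH1 u ∧ K p u = lam ∧ J c u = r}.Nonempty := by
  let χ : ContDiffBump (0 : E n) := ⟨1, 2, one_pos, one_lt_two⟩
  have hu : MemH1 (χ : E n → ℝ) := memH1_of_contDiff χ.contDiff χ.hasCompactSupport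
  have h0 : 0 < K p (χ : E n → ℝ) := by
    refine lt_of_le_of_ne (K_nonneg hp _) fun h => ?_
    have h1 := ae_eq_zero_of_K_eq_zero hp hu h.symm
    have h2 : (χ : E n → ℝ) = 0 :=
      Continuous.ae_eq_iff_eq volume χ.continuous continuous_zero |>.1 h1
    have h3 := congrFun h2 0
    rw [χ.one_of_mem_closedBall (by simp [χ])] at h3
    exact one_ne_zero h3
  obtain ⟨v, hv, hK, -⟩ := exists_scaled hp c hu h0 hlam
  exact ⟨_, v, hv, hK, rfl⟩

/-- The constrained problem in scale-invariant form, free of the constraint. It bounds the energy of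
the remainders in the splitting and later yields the Euler–Lagrange equation. -/
theorem mInf_one_mul_le (hp : Subcritical n p) {c : E n} (hc : ‖c‖ < 1) {u : E n → ℝ}
    (hu : MemH1 u) : mInf c p 1 * K p u ^ (2 / (p + 1)) ≤ J c u := by
  have hr : 0 < p + 1 := by linarith [hp.1]
  rcases (K_nonneg hp u).eq_or_lt with h | h
  · rw [← h, Real.zero_rpow (by positivity), mul_zero]
    exact J_nonneg hc hu
  · obtain ⟨v, hv, hK, hJ⟩ := exists_scaled hp c hu h one_pos
    have h1 := mInf_le (p := p) hc hv
    rw [hK, hJ, one_div, Real.inv_rpow h.le] at h1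
    have h2 : 0 < K p u ^ (2 / (p + 1)) := by positivity
    rw [inv_mul_eq_div, le_div_iff₀ h2] at h1
    exact h1

theorem mInf_eq (hp : Subcritical n p) {c : E n} (hc : ‖c‖ < 1) {lam : ℝ} (hlam : 0 < lam) :
    mInf c p lam = mInf c p 1 * lam ^ (2 / (p + 1)) := by
  refine le_antisymm ?_ ?_
  · have hpos : 0 < lam ^ (2 / (p + 1)) := by positivity
    rw [← div_le_iff₀ hpos]
    refine le_csInf (feasible_nonempty hp c one_pos) ?_
    rintro r ⟨u, hu, hK, rfl⟩
    obtain ⟨v, hv, hKv, hJ⟩ := exists_scaled hp c hu (by rw [hK]; exact one_pos) hlam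
    have h1 := mInf_le (p := p) hc hv
    rw [hKv, hJ, hK, div_one] at h1
    rw [div_le_iff₀ hpos, mul_comm]
    exact h1
  · refine le_csInf (feasible_nonempty hp c hlam) ?_
    rintro r ⟨u, hu, hK, rfl⟩
    rw [← hK]
    exact mInf_one_mul_le hp hc hu

theorem mInf_one_pos (hp : Subcritical n p) {c : E n} (hc : ‖c‖ < 1) : 0 < mInf c p 1 := by
  have hr : 0 < p + 1 := by linarith [hp.1]
  obtain ⟨C, hC0, hC⟩ := exists_K_le (n := n) hp
  have h1c : 0 < 1 - ‖c‖ ^ 2 := by nlinarith [norm_nonneg c]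
  -- From 1 = K(u) ≤ C‖u‖^(p+1) the norm is bounded below; C + 1 replaces C so that the denominator
  -- is positive even for C = 0.
  set b := (1 / (C + 1)) ^ (1 / (p + 1))
  have hb : 0 < b := by positivity
  refine lt_of_lt_of_le (show 0 < (1 - ‖c‖ ^ 2) / 2 * b ^ 2 by positivity) ?_
  refine le_csInf (feasible_nonempty hp c one_pos) ?_
  rintro r ⟨u, hu, hK, rfl⟩
  have h1 := hC u hu
  rw [hK] at h1
  have h2 : b ≤ ‖jet u‖ := by
    have h3 : 1 / (C + 1) ≤ ‖jet u‖ ^ (p + 1) := by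
      rw [div_le_iff₀ (by positivity)]
      have : 0 ≤ ‖jet u‖ ^ (p + 1) := by positivity
      nlinarith
    have h4 := Real.rpow_le_rpow (by positivity) h3 (show 0 ≤ 1 / (p + 1) by positivity)
    rwa [← Real.rpow_mul (norm_nonneg _), mul_one_div_cancel hr.ne', Real.rpow_one] at h4
  have h3 := norm_jet_sq_le hc hu
  rw [div_mul_eq_mul_div, le_div_iff₀ h1c] at h3
  have h4 := pow_le_pow_left₀ hb.le h2 2
  nlinarith

/-- Strict subadditivity of `lam ↦ lam ^ a` for `0 < a < 1`. -/
theorem rpow_lt_add_rpow {a s t : ℝ} (ha1 : a < 1) (hs : 0 < s) (ht : 0 < t) :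
    (s + t) ^ a < s ^ a + t ^ a := by
  have hst : 0 < s + t := by positivity
  have key : ∀ x : ℝ, 0 < x → x < s + t → x / (s + t) * (s + t) ^ a < x ^ a := fun x hx hlt => by
    have h1 : x / (s + t) < (x / (s + t)) ^ a := by
      conv_lhs => rw [← Real.rpow_one (x / (s + t))]
      exact Real.rpow_lt_rpow_of_exponent_gt (by positivity) ((div_lt_one hst).2 hlt) ha1
    rw [Real.div_rpow hx.le hst.le] at h1
    have h2 : 0 < (s + t) ^ a := by positivity
    rwa [lt_div_iff₀ h2] at h1
  have h1 := key s hs (by linarith)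
  have h2 := key t ht (by linarith)
  have h3 : s / (s + t) * (s + t) ^ a + t / (s + t) * (s + t) ^ a = (s + t) ^ a := by
    rw [← add_mul, ← add_div, div_self hst.ne', one_mul]
  linarith

/-! ### Compactness of minimizing sequences -/

/-- Vanishing is excluded by K → lam > 0 and splitting by strict subadditivity, so translation is
the only possible loss of compactness. -/
theorem exists_compact_minimizing (hp : Subcritical n p) {c : E n} (hc : ‖c‖ < 1) {lam : ℝ}
    (hlam : 0 < lam) {u : ℕ → E n → ℝ} (hu : IsMinimizingSeq c p lam u) :
    ∃ k : ℕ → ℕ, StrictMono k ∧ ∃ (y : ℕ → E n) (φ : E n → ℝ), MemH1 φ ∧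
      Tendsto (fun j => h1Norm (fun x => u (k j) (x + y j) - φ x)) atTop (𝓝 0) ∧
      IsConstrainedMinimizer c p lam φ := by
  obtain ⟨hmem, hJ, hK⟩ := hu
  have hr : 0 < p + 1 := by linarith [hp.1]
  have h1c : 0 < 1 - ‖c‖ ^ 2 := by nlinarith [norm_nonneg c]
  obtain ⟨B, hB⟩ := hJ.bddAbove_range
  have hM : ∀ k, ‖jet (u k)‖ ≤ Real.sqrt (2 / (1 - ‖c‖ ^ 2) * B) := fun k => by
    refine Real.le_sqrt_of_sq_le ((norm_jet_sq_le hc (hmem k)).trans ?_)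
    have : J c (u k) ≤ B := hB ⟨k, rfl⟩
    gcongr
  set M := Real.sqrt (2 / (1 - ‖c‖ ^ 2) * B)
  have hnv : ¬ Tendsto (fun k => eLpNorm (toL2 (u k)) (ENNReal.ofReal (p + 1)) volume) atTop
      (𝓝 0) := fun h =>
    hlam.ne' (tendsto_nhds_unique hK (tendsto_K_zero hp hmem h))
  obtain ⟨k, y, φ, hk, hφ, hφ0, hweak⟩ := exists_translates_weakTendsto
    (by linarith [hp.1] : 2 < p + 1) hp.2 hmem hM hnv
  obtain ⟨l, hl, hae⟩ := exists_subseq_tendsto_ae (fun j => (hmem (k j)).translate (y j))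
    (fun j => by rw [norm_jet_translate (hmem _)]; exact hM _) hφ hweak
  let w : ℕ → E n → ℝ := fun j x => u (k (l j)) (x + y (l j))
  have hw : ∀ j, MemH1 (w j) := fun j => (hmem _).translate _
  have hwM : ∀ j, ‖jet (w j)‖ ≤ M := fun j => by
    rw [norm_jet_translate (hmem _)]; exact hM _
  have hd : ∀ j, MemH1 fun x => w j x - φ x := fun j => (hw j).sub hφ
  have hkl : Tendsto (fun j => k (l j)) atTop atTop := (hk.comp hl).tendsto_atTop
  have hJw : Tendsto (fun j => J c (w j)) atTop (𝓝 (mInf c p lam)) :=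
    (hJ.comp hkl).congr fun j => (J_translate c (hmem _) _).symm
  have hKw : Tendsto (fun j => K p (w j)) atTop (𝓝 lam) :=
    (hK.comp hkl).congr fun j => (K_translate _ _).symm
  have hKd : Tendsto (fun j => K p fun x => w j x - φ x) atTop (𝓝 (lam - K p φ)) := by
    have := hKw.sub (tendsto_K_sub hp hw hwM hφ hae)
    simpa using this
  have hJd : Tendsto (fun j => J c fun x => w j x - φ x) atTop (𝓝 (mInf c p lam - J c φ)) := by
    have h1 := (tendsto_Q_sub (c := c) (hweak.comp hl)).const_mul (1 / 2)
    have h2 := hJw.sub h1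
    rw [← J_eq c hφ] at h2
    refine h2.congr fun j => ?_
    rw [J_eq c (hw j), J_eq c (hd j), jet_sub (hw j) hφ]
    ring
  set m := mInf c p 1
  have hm : 0 < m := mInf_one_pos hp hc
  set a := 2 / (p + 1)
  have ha0 : 0 < a := by positivity
  have ha1 : a < 1 := by
    rw [div_lt_one hr]; linarith [hp.1]
  have hKφ : 0 < K p φ := by
    refine lt_of_le_of_ne (K_nonneg hp φ) fun h => hφ0 ?_
    refine (Lp.eq_zero_iff_ae_eq_zero).2 ?_
    filter_upwards [ae_eq_toL2 hφ.memLp, ae_eq_zero_of_K_eq_zero hp hφ h.symm] with x h1 h2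
    rw [h1, h2]; simp
  have hle : 0 ≤ lam - K p φ := ge_of_tendsto' hKd fun j => K_nonneg hp _
  -- The scale-invariant bound for the remainders, passed to the limit.
  have hJge : m * (lam - K p φ) ^ a ≤ mInf c p lam - J c φ :=
    le_of_tendsto_of_tendsto' ((hKd.rpow_const (Or.inr ha0.le)).const_mul m) hJd
      fun j => mInf_one_mul_le hp hc (hd j)
  have hJφ : m * K p φ ^ a ≤ J c φ := mInf_one_mul_le hp hc hφ
  -- If some mass were lost, the bounds for φ and for the remainders would add up to more than m
  -- lam^a, the total energy.
  have hKeq : K p φ = lam := by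
    by_contra hne
    have hlt : 0 < lam - K p φ := lt_of_le_of_ne hle fun h => hne (by linarith)
    have h1 := rpow_lt_add_rpow ha1 hKφ hlt
    rw [add_sub_cancel] at h1
    have h2 := mul_lt_mul_of_pos_left h1 hm
    rw [mInf_eq hp hc hlam] at hJge
    rw [mul_add] at h2
    linarith
  have hmin : mInf c p lam ≤ J c φ := by rw [← hKeq]; exact mInf_le hc hφ
  have hJeq : J c φ = mInf c p lam := by
    rw [hKeq, sub_self, Real.zero_rpow ha0.ne', mul_zero] at hJge
    linarith
  refine ⟨k ∘ l, hk.comp hl, y ∘ l, φ, hφ, ?_, hφ, hKeq, fun v hv hKv => ?_⟩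
  · rw [hJeq, sub_self] at hJd
    have h1 := (hJd.const_mul (2 / (1 - ‖c‖ ^ 2))).sqrt
    rw [mul_zero, Real.sqrt_zero] at h1
    refine squeeze_zero (fun j => Real.sqrt_nonneg _) (fun j => ?_) h1
    refine (norm_jet (hd j)).ge.trans ?_
    exact Real.le_sqrt_of_sq_le (norm_jet_sq_le hc (hd j))
  · rw [hJeq, ← hKv]
    exact mInf_le hc hv

theorem exists_minimizingSeq (hp : Subcritical n p) {c : E n} (hc : ‖c‖ < 1) {lam : ℝ}
    (hlam : 0 < lam) : ∃ u : ℕ → E n → ℝ, IsMinimizingSeq c p lam u := by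
  obtain ⟨s, -, hs, hmem⟩ := exists_seq_tendsto_sInf (feasible_nonempty hp c hlam)
    (bddBelow_J (p := p) hc lam)
  choose u hu hK hJ using hmem
  refine ⟨u, hu, ?_, ?_⟩
  · simp only [hJ]; exact hs
  · simp only [hK]; exact tendsto_const_nhds

theorem IsConstrainedMinimizer.J_eq_mInf {c : E n} {lam : ℝ} {φ : E n → ℝ} (hc : ‖c‖ < 1)
    (h : IsConstrainedMinimizer c p lam φ) : J c φ = mInf c p lam := by
  obtain ⟨hφ, hK, hmin⟩ := h
  refine le_antisymm (le_csInf ⟨_, φ, hφ, hK, rfl⟩ ?_) (by rw [← hK]; exact mInf_le hc hφ)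
  rintro r ⟨v, hv, hKv, rfl⟩
  exact hmin v hv hKv

/-! ### The Euler–Lagrange equation -/

/-- Differentiation under the integral; for |t| < 1 the derivative is dominated by (p+1)(|φ| +
|v|)^(p+1), integrable by the Sobolev embedding. The factor p + 1 cancels the normalization of `K`.
-/
theorem hasDerivAt_K (hp : Subcritical n p) {φ v : E n → ℝ} (hφ : MemH1 φ) (hv : MemH1 v) :
    HasDerivAt (fun t : ℝ => K p fun x => φ x + t * v x)
      (∫ x, |φ x| ^ (p - 1) * φ x * v x) 0 := by
  have hr : 0 < p + 1 := by linarith [hp.1]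
  have hb : Integrable (fun x => (p + 1) * (|φ x| + |v x|) ^ (p + 1)) volume := by
    have h1 : MemLp (fun x => |φ x| + |v x|) (ENNReal.ofReal (p + 1)) volume :=
      (hp.memLp hφ).abs.add (hp.memLp hv).abs
    have h2 := h1.integrable_norm_rpow (by simpa using hr) ENNReal.ofReal_ne_top
    rw [ENNReal.toReal_ofReal hr.le] at h2
    refine (h2.congr (ae_of_all _ fun x => ?_)).const_mul _
    dsimp only
    rw [Real.norm_eq_abs, abs_of_nonneg (by positivity)]
  have hF : ∀ t : ℝ, Integrable (fun x => |φ x + t * v x| ^ (p + 1)) volume := fun t =>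
    hp.integrable (hφ.add (hv.const_mul t))
  have hd := (hasDerivAt_integral_of_dominated_loc_of_deriv_le (μ := volume)
    (F := fun t x => |φ x + t * v x| ^ (p + 1))
    (F' := fun t x => (p + 1) * |φ x + t * v x| ^ (p + 1 - 2) * (φ x + t * v x) * v x)
    (x₀ := 0) (s := Metric.ball 0 1) (bound := fun x => (p + 1) * (|φ x| + |v x|) ^ (p + 1))
    (Metric.ball_mem_nhds 0 one_pos) (Eventually.of_forall fun t => (hF t).1) (hF 0) ?_
    (ae_of_all _ fun x t ht => ?_) hb (ae_of_all _ fun x t ht => ?_)).2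
  · have h1 := hd.const_mul (1 / (p + 1))
    refine h1.congr_deriv ?_
    rw [← integral_const_mul]
    refine integral_congr_ae (ae_of_all _ fun x => ?_)
    have e : p + 1 - 2 = p - 1 := by ring
    simp only [zero_mul, add_zero, e]
    field_simp
  · have hm : AEMeasurable φ volume := hφ.memLp.1.aemeasurable
    have hm' : AEMeasurable v volume := hv.memLp.1.aemeasurable
    refine AEMeasurable.aestronglyMeasurable ?_
    have h0 : AEMeasurable (fun x => φ x + 0 * v x) volume := hm.add (hm'.const_mul 0)
    exact (((h0.abs.pow_const (p + 1 - 2)).const_mul (p + 1)).mul h0).mul hm'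
  · have ht' : |t| < 1 := by simpa using ht
    have h1 : |φ x + t * v x| ≤ |φ x| + |v x| := by
      refine (abs_add_le _ _).trans (add_le_add_right ?_ _)
      rw [abs_mul]
      exact mul_le_of_le_one_left (abs_nonneg _) ht'.le
    have h2 : |v x| ≤ |φ x| + |v x| := by linarith [abs_nonneg (φ x)]
    rw [norm_mul, norm_mul, norm_mul, Real.norm_eq_abs, Real.norm_eq_abs, Real.norm_eq_abs,
      Real.norm_eq_abs, abs_of_pos hr, abs_of_nonneg (Real.rpow_nonneg (abs_nonneg _) _)]
    set A := |φ x| + |v x|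
    have hA : 0 ≤ A := by positivity
    calc (p + 1) * |φ x + t * v x| ^ (p + 1 - 2) * |φ x + t * v x| * |v x|
        ≤ (p + 1) * A ^ (p + 1 - 2) * A * A := by
          have : 0 ≤ p + 1 - 2 := by linarith [hp.1]
          gcongr
      _ = (p + 1) * A ^ (p + 1) := by
          have e : p + 1 = (p + 1 - 2) + 2 := by ring
          conv_rhs => rw [e, Real.rpow_add_of_nonneg hA (by linarith [hp.1]) (by norm_num)]
          rw [Real.rpow_two]
          ring
  · have h1 : HasDerivAt (fun t : ℝ => φ x + t * v x) (v x) t := by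
      simpa using ((hasDerivAt_id t).mul_const (v x)).const_add (φ x)
    exact (hasDerivAt_abs_rpow (φ x + t * v x) (by linarith [hp.1] : 1 < p + 1)).comp t h1

/-- The Lagrange multiplier rule for constrained minimizers. -/
theorem IsConstrainedMinimizer.isWeakSolution (hp : Subcritical n p) {c : E n} (hc : ‖c‖ < 1)
    {lam : ℝ} (hlam : 0 < lam) {φ : E n → ℝ} (h : IsConstrainedMinimizer c p lam φ) :
    IsWeakSolution c p (mInf c p 1 * (2 / (p + 1)) * lam ^ (2 / (p + 1) - 1)) φ := by
  have hr : 0 < p + 1 := by linarith [hp.1]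
  have hJ := h.J_eq_mInf hc
  obtain ⟨hφ, hK, -⟩ := h
  refine ⟨hφ, fun v hv => ?_⟩
  rw [← Qpolar_jet c hφ hv]
  set m := mInf c p 1
  set a := 2 / (p + 1)
  -- F is nonnegative by the scale-invariant inequality and zero at t = 0, so no variation has to be
  -- projected back to the constraint. Since K(φ) = lam ≠ 0, the power `a` is differentiable there.
  let F : ℝ → ℝ := fun t => J c (fun x => φ x + t * v x) - m * (K p fun x => φ x + t * v x) ^ a
  have hF0 : F 0 = 0 := by
    simp only [F, zero_mul, add_zero, hK, hJ, mInf_eq hp hc hlam, sub_self, m, a]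
  have hFmin : IsLocalMin F 0 := Eventually.of_forall fun t => by
    rw [hF0]
    exact sub_nonneg.2 (mInf_one_mul_le hp hc (hφ.add (hv.const_mul t)))
  have hJt : ∀ t : ℝ, J c (fun x => φ x + t * v x) =
      1 / 2 * (Q c (jet φ) + t ^ 2 * Q c (jet v) + 2 * (t * Qpolar c (jet φ) (jet v))) :=
    fun t => by
      rw [J_eq c (hφ.add (hv.const_mul t)), jet_add hφ (hv.const_mul t), jet_const_mul hv, Q_add,
        Q_smul, map_smul, smul_eq_mul]
  have hJd : HasDerivAt (fun t : ℝ => J c fun x => φ x + t * v x)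
      (Qpolar c (jet φ) (jet v)) 0 := by
    simp only [hJt]
    have h1 : HasDerivAt (fun t : ℝ => t ^ 2 * Q c (jet v)) 0 0 := by
      simpa using ((hasDerivAt_id (0 : ℝ)).pow 2).mul_const (Q c (jet v))
    have h2 : HasDerivAt (fun t : ℝ => 2 * (t * Qpolar c (jet φ) (jet v)))
        (2 * Qpolar c (jet φ) (jet v)) 0 := by
      simpa using ((hasDerivAt_id (0 : ℝ)).mul_const (Qpolar c (jet φ) (jet v))).const_mul 2
    refine (((h1.const_add (Q c (jet φ))).add h2).const_mul (1 / 2)).congr_deriv ?_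
    ring
  have hKd := (hasDerivAt_K hp hφ hv).rpow_const (p := a)
    (Or.inl (by simpa [hK] using hlam.ne'))
  simp only [zero_mul, add_zero, hK] at hKd
  have := hFmin.hasDerivAt_eq_zero (hJd.sub (hKd.const_mul m))
  linear_combination this

/-- The factor s with s^(p−1) = l absorbs the multiplier, because the left side of the equation is
linear and the right side has degree p. The resulting level does not depend on lam. -/
theorem IsConstrainedMinimizer.isGroundState (hp : Subcritical n p) {c : E n} (hc : ‖c‖ < 1)
    {lam : ℝ} (hlam : 0 < lam) {φ : E n → ℝ} (h : IsConstrainedMinimizer c p lam φ) {l : ℝ}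
    (hl : l = mInf c p 1 * (2 / (p + 1)) * lam ^ (2 / (p + 1) - 1)) :
    IsGroundState c p fun x => l ^ (1 / (p - 1)) * φ x := by
  have hr : 0 < p + 1 := by linarith [hp.1]
  have hp1 : 0 < p - 1 := by linarith [hp.1]
  have hsol := h.isWeakSolution hp hc hlam
  rw [← hl] at hsol
  have hJ := h.J_eq_mInf hc
  rw [mInf_eq hp hc hlam] at hJ
  obtain ⟨hφ, hK, -⟩ := h
  have hm : 0 < mInf c p 1 := mInf_one_pos hp hc
  set m := mInf c p 1
  have hl0 : 0 < l := by rw [hl]; positivity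
  set s := l ^ (1 / (p - 1))
  have hs : 0 < s := by positivity
  have hsl : s ^ (p - 1) = l := by
    simp only [s]
    rw [← Real.rpow_mul hl0.le, one_div_mul_cancel hp1.ne', Real.rpow_one]
  have hKs : K p (fun x => s * φ x) = s ^ (p + 1) * lam := by rw [K_const_mul _ hs.le, hK]
  have hJs : J c (fun x => s * φ x) = s ^ 2 * (m * lam ^ (2 / (p + 1))) := by
    rw [J_const_mul c hφ, hJ]
  have hsp : s ^ (p + 1) = s ^ 2 * l := by
    rw [← hsl, ← Real.rpow_two, ← Real.rpow_add hs]; congr 1; ring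
  have hlam1 : lam ^ (2 / (p + 1) - 1) * lam = lam ^ (2 / (p + 1)) := by
    conv_lhs => rw [← Real.rpow_one lam, ← Real.rpow_mul hlam.le, one_mul, ← Real.rpow_add hlam]
    rw [sub_add_cancel]
  have hls : l * lam = m * (2 / (p + 1)) * lam ^ (2 / (p + 1)) := by
    rw [hl, mul_assoc, hlam1]
  refine ⟨⟨hφ.const_mul s, fun v hv => ?_⟩, fun h0 => ?_, ?_, ?_, ?_⟩
  · have h1 := hsol.2 v hv
    rw [← Qpolar_jet c hφ hv] at h1
    rw [← Qpolar_jet c (hφ.const_mul s) hv, jet_const_mul hφ, one_mul]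
    have h2 : Qpolar c (s • jet φ) (jet v) = s * Qpolar c (jet φ) (jet v) := by
      rw [Qpolar_apply, Qpolar_apply, map_smul, real_inner_smul_left, real_smul_eq_coe_smul,
        inner_smul_left, Complex.conj_ofReal, Complex.re_ofReal_mul]
      ring
    rw [h2, h1, ← mul_assoc, ← integral_const_mul]
    refine integral_congr_ae (ae_of_all _ fun x => ?_)
    dsimp only
    rw [abs_mul, abs_of_pos hs, Real.mul_rpow hs.le (abs_nonneg _), hsl]
    ring
  · have : K p (fun x => s * φ x) = 0 := by
      rw [K]
      have h1 : ∫ x, |s * φ x| ^ (p + 1) = 0 := by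
        refine integral_eq_zero_of_ae ?_
        filter_upwards [h0] with x hx
        rw [hx]; simp [Real.zero_rpow hr.ne']
      rw [h1, mul_zero]
    rw [hKs] at this
    have h2 : 0 < s ^ (p + 1) * lam := by positivity
    exact h2.ne' this
  · rw [hJs, hKs, Real.mul_rpow (by positivity) hlam.le, ← Real.rpow_mul hs.le,
      mul_div_cancel₀ _ hr.ne', Real.rpow_two]
    field_simp
    rfl
  · rw [hJs, hKs, hsp, mul_assoc (s ^ 2), hls]
    field_simp
  · rw [hJs]
    have e1 : s ^ 2 = l ^ (2 / (p - 1)) := by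
      rw [← Real.rpow_two]
      simp only [s]
      rw [← Real.rpow_mul hl0.le]
      congr 1; ring
    have e2 : (p + 1) / (p - 1) = 2 / (p - 1) + 1 := by field_simp; ring
    have e3 : m ^ ((p + 1) / (p - 1)) = m ^ (2 / (p - 1)) * m := by
      rw [e2, Real.rpow_add hm, Real.rpow_one]
    -- The powers of lam coming from l and from J(φ) cancel exactly.
    have e4 : (lam ^ (2 / (p + 1) - 1)) ^ (2 / (p - 1)) * lam ^ (2 / (p + 1)) = 1 := by
      rw [← Real.rpow_mul hlam.le, ← Real.rpow_add hlam]
      have : (2 / (p + 1) - 1) * (2 / (p - 1)) + 2 / (p + 1) = 0 := by field_simp; ring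
      rw [this, Real.rpow_zero]
    rw [e1, e3, hl, Real.mul_rpow (by positivity) (by positivity),
      Real.mul_rpow (by positivity) (by positivity)]
    linear_combination (2 * m ^ (2 / (p - 1)) * (2 / (p + 1)) ^ (2 / (p - 1)) * m) * e4

end BoussinesqWave

end

/-! ### The main theorem -/

theorem theorem2p1 (n : ℕ) (hn : 2 ≤ n) (p : ℝ) (hp : 1 < p)
    (hp_sub : 2 < n → p < ((n : ℝ) + 2) / ((n : ℝ) - 2))
    (c : BoussinesqWave.E n) (hc : ‖c‖ < 1) :
    (∀ lam : ℝ, 0 < lam → ∀ u : ℕ → BoussinesqWave.E n → ℝ,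
      BoussinesqWave.IsMinimizingSeq c p lam u →
        ∃ k : ℕ → ℕ, StrictMono k ∧ ∃ (y : ℕ → BoussinesqWave.E n) (φ : BoussinesqWave.E n → ℝ),
          BoussinesqWave.MemH1 φ ∧
          Tendsto (fun j => BoussinesqWave.h1Norm (fun x => u (k j) (x + y j) - φ x))
            atTop (𝓝 0) ∧
          BoussinesqWave.IsConstrainedMinimizer c p lam φ) ∧
    (∀ lam : ℝ, 0 < lam →
      ∃ φ : BoussinesqWave.E n → ℝ, BoussinesqWave.IsConstrainedMinimizer c p lam φ) ∧
    (∀ lam : ℝ, 0 < lam → ∀ φ : BoussinesqWave.E n → ℝ,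
      BoussinesqWave.IsConstrainedMinimizer c p lam φ →
        ∃ ℓ : ℝ, 0 < ℓ ∧ BoussinesqWave.IsWeakSolution c p ℓ φ ∧
          BoussinesqWave.IsGroundState c p (fun x => ℓ ^ (1 / (p - 1)) * φ x)) := by
  have hs : BoussinesqWave.Subcritical n p := BoussinesqWave.subcritical_of_lt hn hp hp_sub
  refine ⟨fun lam hlam u hu => BoussinesqWave.exists_compact_minimizing hs hc hlam hu,
    fun lam hlam => ?_, fun lam hlam φ hφ => ?_⟩
  · obtain ⟨u, hu⟩ := BoussinesqWave.exists_minimizingSeq hs hc hlam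
    obtain ⟨-, -, -, φ, -, -, hφ⟩ := BoussinesqWave.exists_compact_minimizing hs hc hlam hu
    exact ⟨φ, hφ⟩
  · have hm := BoussinesqWave.mInf_one_pos hs hc
    have hp0 : 0 < p + 1 := by linarith
    exact ⟨_, by positivity, hφ.isWeakSolution hs hc hlam, hφ.isGroundState hs hc hlam rfl⟩
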